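/- **Setting.** Let $d\ge 3$, let $M$ be a finite set, let $T_d$ be the infinite $d$-regular tree with root $o$, and let $\mu$ be a probability measure on $M^{T_d}$ which is invariant under all automorphisms of $T_d$. Let $\mathcal G^\bullet_M$ be the set of connected, locally finite, rooted, $M$-colored graphs whose vertices are finite sequences of positive integers forming a breadth-first search labeling (the root being the empty sequence), with the distance $\sum_{r\ge 0}2^{-r}\mathbf 1_{(g)_r\ne (g')_r}$, where $(g)_r$ is the restriction of $g$ to the vertices at distance at most $r$ from the root. Let $\mathrm d$ be any distance on the set $\mathcal P(\mathcal G^\bullet_M)$ of Borel probability measures which generates the weak topology. For a graph $G$ on $[n]$ and $f:[n]\to M$, let $\mathrm{distr}_G(f)\in\mathcal P(\mathcal G^\bullet_M)$ be the average over $v\in[n]$ of the laws of the connected component of $v$ in $(G,f)$, rooted at $v$ and labeled by the breadth-first search started at $v$ in which ties are broken uniformly at random. The measure $\mu$ is identified with the law of $(T_d,X,o)$, where $X$ has law $\mu$, and the index $r$ denotes the image of a measure under $g\mapsto (g)_r$. For $r\in\{0,1,2,\dots\}$, $\epsilon>0$ and a graph $G$ on $[n]$ put $$H_G(\mu,r,\epsilon)=\frac1n\log\bigl|\{f\in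 M^n:\ \mathrm d(\mathrm{distr}_G(f)_r,\mu_r)\le\epsilon\}\bigr|\in\{-\infty\}\cup[0,\infty).$$ Let $G_n$ be uniformly distributed on the simple $d$-regular graphs on $[n]$, where $n\ge d+1$ and $nd$ is even (all limits in $n$ are along such $n$). For $0<\alpha<1$ put $$h_n(\mu,r,\epsilon,\alpha)=\sup\{h\in\{-\infty\}\cup[0,\infty):\ \mathbb P(H_{G_n}(\mu,r,\epsilon)\ge h)\ge\alpha\},$$ $$\overline h(\mu,r,\alpha)=\lim_{\epsilon\to0}\limsup_{n\to\infty}h_n(\mu,r,\epsilon,\alpha),\qquad \underline h(\mu,r,\alpha)=\lim_{\epsilon\to0}\liminf_{n\to\infty}h_n(\mu,r,\epsilon,\alpha).$$ **Theorem.** Let $r\ge0$ be an integer, let $h\in\{-\infty\}\cup[0,\infty)$, and let $\delta:(0,\infty)\to(0,\infty]$ satisfy $\lim_{\epsilon\to0}\delta(\epsilon)=0$. 1. If $\limsup_{n\to\infty}\frac1n\log\mathbb P(H_{G_n}(\mu,r,\epsilon)\ge h)\ge-\delta(\epsilon)$ for all $\epsilon>0$, then $\overline h(\mu,r,\alpha)\ge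 h$ for all $0<\alpha<1$. If the same holds with $\liminf$ in place of $\limsup$, then $\underline h(\mu,r,\alpha)\ge h$ for all $0<\alpha<1$. 2. Assume moreover that $\lim_{\epsilon\to0}\epsilon^{-2}\delta(\epsilon)=0$ and that $\mathrm d$ is at most a constant times the total variation distance (as is the case for the Lévy–Prokhorov distance). If $\liminf_{n\to\infty}\frac1n\log\mathbb P(H_{G_n}(\mu,r,\epsilon)\le h)\ge-\delta(\epsilon)$ for all $\epsilon>0$, then $\overline h(\mu,r,\alpha)\le h$ for all $0<\alpha<1$. If $\limsup_{n\to\infty}\frac1n\log\mathbb P(H_{G_n}(\mu,r,\epsilon)\le h)\ge-\delta(\epsilon)$ for all $\epsilon>0$, then $\underline h(\mu,r,\alpha)\le h$ for all $0<\alpha<1$. Moreover, $\overline h(\mu,r,\alpha)$ and $\underline h(\mu,r,\alpha)$ do not depend on $\alpha\in(0,1)$. -/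

import Mathlib

open Filter Topology MeasureTheory Set
open scoped ENNReal

namespace Sofic

/-! ## Rooted colored graphs on finite integer sequences

Finite sequences of positive integers are lists of natural numbers, the root is the empty list. -/

/-- The order in which a breadth-first search visits labels: first by length (the distance to the
root), then lexicographically. -/
def bfsLE (u w : List ℕ) : Prop :=
  u.length < w.length ∨ (u.length = w.length ∧ u ≤ w)

/-- A connected locally finite graph with vertices colored by `M`, whose vertex set is a set of
finite sequences, rooted at the empty sequence, and labeled by a breadth-first search.
The vertices are the sequences `w` for which `color w` is not `none`. -/
@[ext]
structure RootedGraph (M : Type*) where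
  graph : SimpleGraph (List ℕ)
  color : List ℕ → Option M
  root_mem : (color []).isSome
  adj_mem : ∀ u v, graph.Adj u v → (color u).isSome
  locally_finite : ∀ u, (graph.neighborSet u).Finite
  /-- every vertex different from the root is adjacent to its parent -/
  parent_adj : ∀ w j, (color (w ++ [j])).isSome → graph.Adj w (w ++ [j])
  /-- and the parent is the neighbor that the search visits first -/
  parent_first : ∀ w j u, graph.Adj u (w ++ [j]) → bfsLE w u
  /-- the offspring of a vertex are numbered `1, 2, …` -/
  siblings : ∀ w j, (color (w ++ [j])).isSome →
    1 ≤ j ∧ ∀ i, 1 ≤ i → i ≤ j → (color (w ++ [i])).isSome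

namespace RootedGraph

variable {M : Type*}

/-- Restriction of a rooted graph to the vertices at distance at most `r` from the root (for
breadth-first labels, the distance to the root is the length of the label). -/
def trunc (r : ℕ) (g : RootedGraph M) : RootedGraph M where
  graph :=
    { Adj := fun u v => g.graph.Adj u v ∧ u.length ≤ r ∧ v.length ≤ r
      symm := ⟨fun _ _ h => ⟨h.1.symm, h.2.2, h.2.1⟩⟩
      loopless := ⟨fun _ h => h.1.ne rfl⟩ }
  color := fun w => if w.length ≤ r then g.color w else none
  root_mem := by simpa using g.root_mem
  adj_mem := by
    rintro u v ⟨h, hu, -⟩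
    simpa [hu] using g.adj_mem u v h
  locally_finite := fun u => (g.locally_finite u).subset fun _ h => h.1
  parent_adj := by
    intro w j h
    by_cases hw : (w ++ [j]).length ≤ r
    · rw [if_pos hw] at h
      refine ⟨g.parent_adj w j h, ?_, hw⟩
      simp at hw
      omega
    · rw [if_neg hw] at h
      simp at h
  parent_first := fun w j u h => g.parent_first w j u h.1
  siblings := by
    intro w j h
    by_cases hw : (w ++ [j]).length ≤ r
    · rw [if_pos hw] at h
      refine ⟨(g.siblings w j h).1, fun i h1 h2 => ?_⟩
      have hw' : (w ++ [i]).length ≤ r := by simpa using hw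
      rw [if_pos hw']
      exact (g.siblings w j h).2 i h1 h2
    · rw [if_neg hw] at h
      simp at h

theorem trunc_trunc {r s : ℕ} (h : r ≤ s) (g : RootedGraph M) :
    trunc r (trunc s g) = trunc r g := by
  ext u v
  · simp only [trunc]
    constructor
    · rintro ⟨⟨h1, -, -⟩, h2, h3⟩
      exact ⟨h1, h2, h3⟩
    · rintro ⟨h1, h2, h3⟩
      exact ⟨⟨h1, h2.trans h, h3.trans h⟩, h2, h3⟩
  · simp only [trunc]
    by_cases hu : u.length ≤ r
    · simp [hu, hu.trans h]
    · simp [hu]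

theorem eq_of_trunc_eq {g g' : RootedGraph M} (h : ∀ r, trunc r g = trunc r g') : g = g' := by
  ext u v
  · have h1 := congrArg (fun x => x.graph.Adj u v) (h (max u.length v.length))
    simpa [trunc] using h1
  · have h1 := congrArg (fun x => x.color u) (h u.length)
    simp only [trunc, le_refl, if_true] at h1
    rw [h1]

open Classical in
/-- The `r`-th term of the distance between rooted graphs. -/
noncomputable def distTerm (g g' : RootedGraph M) (r : ℕ) : ℝ :=
  (2⁻¹ : ℝ) ^ r * (if trunc r g ≠ trunc r g' then 1 else 0)

theorem distTerm_nonneg (g g' : RootedGraph M) (r : ℕ) : 0 ≤ distTerm g g' r := by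
  unfold distTerm
  split_ifs <;> simp

theorem distTerm_le (g g' : RootedGraph M) (r : ℕ) : distTerm g g' r ≤ (2⁻¹ : ℝ) ^ r := by
  unfold distTerm
  split_ifs <;> simp

theorem summable_distTerm (g g' : RootedGraph M) : Summable (distTerm g g') :=
  Summable.of_nonneg_of_le (distTerm_nonneg g g') (distTerm_le g g')
    (summable_geometric_of_lt_one (by norm_num) (by norm_num))

/-- The distance `d(g, g') = ∑ r, 2 ^ (-r) * 1_{(g)_r ≠ (g')_r}`. -/
noncomputable instance : MetricSpace (RootedGraph M) where
  dist g g' := ∑' r, distTerm g g' r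
  dist_self g := by simp [distTerm]
  dist_comm g g' := by
    refine tsum_congr fun r => ?_
    unfold distTerm
    by_cases h : trunc r g = trunc r g'
    · simp [h]
    · simp [h, Ne.symm h]
  dist_triangle a b c := by
    rw [← (summable_distTerm a b).tsum_add (summable_distTerm b c)]
    refine (summable_distTerm a c).tsum_le_tsum (fun r => ?_)
      ((summable_distTerm a b).add (summable_distTerm b c))
    have hp : (0 : ℝ) < (2⁻¹ : ℝ) ^ r := by positivity
    simp only [distTerm]
    by_cases h1 : trunc r a = trunc r b
    · rw [h1]
      simp
    · simp only [ne_eq, h1, not_false_eq_true, if_true]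
      split_ifs <;> linarith
  eq_of_dist_eq_zero := by
    intro g g' h
    refine eq_of_trunc_eq fun r => ?_
    have h1 : distTerm g g' r ≤ 0 := by
      refine le_trans ?_ (le_of_eq h)
      exact (summable_distTerm g g').le_tsum r fun j _ => distTerm_nonneg g g' j
    by_contra hne
    simp only [distTerm, ne_eq, hne, not_false_eq_true, if_true, mul_one] at h1
    have hp : (0 : ℝ) < (2⁻¹ : ℝ) ^ r := by positivity
    linarith

noncomputable instance : MeasurableSpace (RootedGraph M) := borel _

instance : BorelSpace (RootedGraph M) := ⟨rfl⟩

theorem trunc_eq_of_dist_lt {g g' : RootedGraph M} {r : ℕ} (h : dist g g' < (2⁻¹ : ℝ) ^ r) :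
    trunc r g = trunc r g' := by
  by_contra hne
  have h1 : distTerm g g' r ≤ dist g g' :=
    (summable_distTerm g g').le_tsum r fun j _ => distTerm_nonneg g g' j
  simp only [distTerm, ne_eq, hne, not_false_eq_true, if_true, mul_one] at h1
  linarith

theorem continuous_trunc (r : ℕ) : Continuous (trunc r : RootedGraph M → RootedGraph M) := by
  rw [Metric.continuous_iff]
  intro g ε hε
  refine ⟨(2⁻¹ : ℝ) ^ r, by positivity, fun g' h => ?_⟩
  rw [trunc_eq_of_dist_lt h, dist_self]
  exact hε

theorem dist_trunc_le (g : RootedGraph M) (r : ℕ) : dist (trunc r g) g ≤ (2⁻¹ : ℝ) ^ r := by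
  have h0 : ∀ i, i ∈ Finset.range (r + 1) → distTerm (trunc r g) g i = 0 := by
    intro i hi
    have : i ≤ r := by simpa [Nat.lt_succ_iff] using hi
    simp [distTerm, trunc_trunc this]
  have h1 : dist (trunc r g) g = ∑' i, distTerm (trunc r g) g (i + (r + 1)) := by
    have := (summable_distTerm (trunc r g) g).sum_add_tsum_nat_add (r + 1)
    rw [Finset.sum_eq_zero h0, zero_add] at this
    exact this.symm
  rw [h1]
  have hs : Summable fun i : ℕ => (2⁻¹ : ℝ) ^ (r + 1) * (2⁻¹ : ℝ) ^ i :=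
    (summable_geometric_of_lt_one (by norm_num) (by norm_num)).mul_left _
  calc ∑' i, distTerm (trunc r g) g (i + (r + 1))
      ≤ ∑' i : ℕ, (2⁻¹ : ℝ) ^ (r + 1) * (2⁻¹ : ℝ) ^ i := by
        refine Summable.tsum_le_tsum (fun i => ?_)
          ((summable_nat_add_iff (r + 1)).2 (summable_distTerm _ _)) hs
        refine (distTerm_le _ _ _).trans (le_of_eq ?_)
        rw [← pow_add, add_comm]
    _ = (2⁻¹ : ℝ) ^ r := by
        rw [tsum_mul_left, tsum_geometric_of_lt_one (by norm_num) (by norm_num), pow_succ]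
        norm_num
        ring

end RootedGraph

/-- The law of the restriction of a random rooted graph to the vertices at distance at most `r`
from the root. -/
noncomputable def restr {M : Type*} (r : ℕ) (ρ : ProbabilityMeasure (RootedGraph M)) :
    ProbabilityMeasure (RootedGraph M) :=
  ρ.map (RootedGraph.continuous_trunc r).measurable.aemeasurable

/-! ## The randomly labeled rooted graph of a vertex of a finite colored graph -/

section BFS

open Classical in
/-- If `prev` gives the labels of the vertices at distance `k` from `o`, this is the label of the
parent of a vertex `u` at distance `k + 1` from `o`: among the neighbors of `u` at distance `k`, the
one that the search visits first. -/
noncomputable def parentLabel {n : ℕ} (G : SimpleGraph (Fin n)) (o : Fin n) (k : ℕ)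
    (prev : Fin n → List ℕ) (u : Fin n) : List ℕ :=
  ((Finset.univ.filter fun w => G.edist o w = k ∧ G.Adj w u).image prev).min.untopD []

open Classical in
/-- The labels of the vertices at distance `k` from `o` in the breadth-first search started at `o`,
where ties are broken by the order `σ`: the label of a vertex is the label of its parent, followed
by its rank for `σ` among the offspring of its parent. -/
noncomputable def levelLabel {n : ℕ} (G : SimpleGraph (Fin n)) (o : Fin n)
    (σ : Equiv.Perm (Fin n)) : ℕ → Fin n → List ℕ
  | 0, _ => []
  | k + 1, v =>
    parentLabel G o k (levelLabel G o σ k) v ++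
      [(Finset.univ.filter fun u => G.edist o u = ((k + 1 : ℕ) : ℕ∞) ∧
        parentLabel G o k (levelLabel G o σ k) u = parentLabel G o k (levelLabel G o σ k) v ∧
        σ u ≤ σ v).card]

/-- The breadth-first search label of a vertex `v` in the connected component of `o`. -/
noncomputable def bfsLabel {n : ℕ} (G : SimpleGraph (Fin n)) (o : Fin n)
    (σ : Equiv.Perm (Fin n)) (v : Fin n) : List ℕ :=
  levelLabel G o σ (G.dist o v) v

variable {n : ℕ} (G : SimpleGraph (Fin n)) (o : Fin n) (σ : Equiv.Perm (Fin n))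

theorem exists_pred {k : ℕ} {v : Fin n} (h : G.edist o v = ((k + 1 : ℕ) : ℕ∞)) :
    ∃ w, G.edist o w = k ∧ G.Adj w v := by
  obtain ⟨p, hp⟩ := SimpleGraph.exists_walk_of_edist_eq_coe h
  have hnil : ¬ p.Nil := by
    intro hn
    rw [← SimpleGraph.Walk.length_eq_zero_iff] at hn
    omega
  refine ⟨p.penultimate, ?_, p.adj_penultimate hnil⟩
  have h1 : G.edist o p.penultimate ≤ k := by
    refine (SimpleGraph.edist_le p.dropLast).trans ?_
    have : p.dropLast.length = k := by
      have := congrArg SimpleGraph.Walk.length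
        (SimpleGraph.Walk.concat_dropLast (p := p) (p.adj_penultimate hnil))
      rw [SimpleGraph.Walk.length_concat] at this
      omega
    rw [this]
  have h2 : G.edist o v ≤ G.edist o p.penultimate + 1 := by
    refine (SimpleGraph.edist_triangle (v := p.penultimate)).trans ?_
    gcongr
    exact (SimpleGraph.edist_eq_one_iff_adj.2 (p.adj_penultimate hnil)).le
  rw [h] at h2
  have hne : G.edist o p.penultimate ≠ ⊤ := ne_top_of_le_ne_top (by simp) h1
  obtain ⟨m, hm⟩ := ENat.ne_top_iff_exists.1 hne
  rw [← hm] at h1 h2 ⊢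
  norm_cast at h1 h2 ⊢
  omega

theorem parentLabel_spec {k : ℕ} (prev : Fin n → List ℕ) {v : Fin n}
    (h : G.edist o v = ((k + 1 : ℕ) : ℕ∞)) :
    (∃ w, G.edist o w = k ∧ G.Adj w v ∧ prev w = parentLabel G o k prev v) ∧
      ∀ w, G.edist o w = k → G.Adj w v → parentLabel G o k prev v ≤ prev w := by
  classical
  obtain ⟨w0, hw0⟩ := exists_pred G o h
  set S := (Finset.univ.filter fun w => G.edist o w = k ∧ G.Adj w v).image prev with hS
  have hne : S.Nonempty := ⟨prev w0, Finset.mem_image_of_mem _ (by simpa using hw0)⟩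
  have hpl : parentLabel G o k prev v = S.min' hne := by
    unfold parentLabel
    have : S.min.untopD [] = S.min' hne := by rw [← Finset.coe_min' hne]; rfl
    rw [← this, hS]
  rw [hpl]
  constructor
  · have := S.min'_mem hne
    obtain ⟨w, hw, he⟩ := Finset.mem_image.1 this
    simp only [Finset.mem_filter, Finset.mem_univ, true_and] at hw
    exact ⟨w, hw.1, hw.2, he⟩
  · intro w h1 h2
    exact S.min'_le _ (Finset.mem_image_of_mem _ (by simp [h1, h2]))

theorem length_levelLabel (k : ℕ) (v : Fin n) (h : G.edist o v = k) :
    (levelLabel G o σ k v).length = k := by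
  induction k generalizing v with
  | zero => rfl
  | succ k ih =>
    obtain ⟨⟨w, h1, -, h3⟩, -⟩ := parentLabel_spec G o (levelLabel G o σ k) h
    simp [levelLabel, ← h3, ih w h1]

theorem levelLabel_inj (k : ℕ) (u v : Fin n) (hu : G.edist o u = k) (hv : G.edist o v = k)
    (h : levelLabel G o σ k u = levelLabel G o σ k v) : u = v := by
  cases k with
  | zero =>
    have hu' : o = u := (SimpleGraph.edist_eq_zero_iff (G := G)).1 hu
    have hv' : o = v := (SimpleGraph.edist_eq_zero_iff (G := G)).1 hv
    rw [← hu', ← hv']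
  | succ k =>
    simp only [levelLabel] at h
    obtain ⟨hp, hc⟩ := List.append_inj' h rfl
    simp only [List.cons.injEq, and_true] at hc
    wlog hle : σ u ≤ σ v generalizing u v
    · exact (this v u hv hu h.symm hp.symm hc.symm (le_of_not_ge hle)).symm
    have hsub := Finset.eq_of_subset_of_card_le (s := Finset.univ.filter fun x =>
        G.edist o x = ((k + 1 : ℕ) : ℕ∞) ∧
        parentLabel G o k (levelLabel G o σ k) x = parentLabel G o k (levelLabel G o σ k) u ∧
        σ x ≤ σ u) (t := Finset.univ.filter fun x =>
        G.edist o x = ((k + 1 : ℕ) : ℕ∞) ∧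
        parentLabel G o k (levelLabel G o σ k) x = parentLabel G o k (levelLabel G o σ k) v ∧
        σ x ≤ σ v) (by
          intro x hx
          simp only [Finset.mem_filter, Finset.mem_univ, true_and] at hx ⊢
          exact ⟨hx.1, hx.2.1.trans hp, hx.2.2.trans hle⟩) (le_of_eq (by convert hc.symm))
    have hmem : v ∈ Finset.univ.filter fun x =>
        G.edist o x = ((k + 1 : ℕ) : ℕ∞) ∧
        parentLabel G o k (levelLabel G o σ k) x = parentLabel G o k (levelLabel G o σ k) u ∧
        σ x ≤ σ u := by
      rw [hsub]
      simpa using hv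
    simp only [Finset.mem_filter, Finset.mem_univ, true_and] at hmem
    exact σ.injective (le_antisymm hle hmem.2.2)

theorem length_bfsLabel {v : Fin n} (h : G.Reachable o v) :
    (bfsLabel G o σ v).length = G.dist o v :=
  length_levelLabel G o σ _ v h.coe_dist_eq_edist.symm

theorem bfsLabel_inj {u v : Fin n} (hu : G.Reachable o u) (hv : G.Reachable o v)
    (h : bfsLabel G o σ u = bfsLabel G o σ v) : u = v := by
  have hd : G.dist o u = G.dist o v := by
    rw [← length_bfsLabel G o σ hu, ← length_bfsLabel G o σ hv, h]
  refine levelLabel_inj G o σ (G.dist o u) u v hu.coe_dist_eq_edist.symm ?_ ?_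
  · rw [hd]; exact hv.coe_dist_eq_edist.symm
  · simpa only [bfsLabel, hd] using h

theorem bfsLabel_of_dist {v : Fin n} {k : ℕ} (h : G.edist o v = k) :
    bfsLabel G o σ v = levelLabel G o σ k v := by
  have : G.dist o v = k := by simp [SimpleGraph.dist, h]
  rw [bfsLabel, this]

theorem reachable_of_edist {v : Fin n} {k : ℕ} (h : G.edist o v = k) : G.Reachable o v :=
  SimpleGraph.reachable_of_edist_ne_top (by simp [h])

/-- A vertex whose label is not that of the root is an offspring. -/
theorem edist_of_label {w : List ℕ} {j : ℕ} {v : Fin n} (hv : G.Reachable o v)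
    (h : bfsLabel G o σ v = w ++ [j]) : G.edist o v = ((w.length + 1 : ℕ) : ℕ∞) := by
  have := length_bfsLabel G o σ hv
  rw [h] at this
  rw [← hv.coe_dist_eq_edist, ← this]
  simp

theorem parent_of_label {w : List ℕ} {j : ℕ} {v : Fin n} (hv : G.Reachable o v)
    (h : bfsLabel G o σ v = w ++ [j]) :
    parentLabel G o w.length (levelLabel G o σ w.length) v = w := by
  rw [bfsLabel_of_dist G o σ (edist_of_label G o σ hv h), levelLabel] at h
  exact (List.append_inj' h rfl).1

theorem siblings_of_label {w : List ℕ} {j : ℕ} {v : Fin n} (hv : G.Reachable o v)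
    (h : bfsLabel G o σ v = w ++ [j]) :
    1 ≤ j ∧ ∀ i, 1 ≤ i → i ≤ j → ∃ u, G.Reachable o u ∧ bfsLabel G o σ u = w ++ [i] := by
  classical
  have hd := edist_of_label G o σ hv h
  have hp := parent_of_label G o σ hv h
  set k := w.length with hk
  set par := parentLabel G o k (levelLabel G o σ k) with hpar
  set A : Finset (Fin n) := Finset.univ.filter fun u =>
    G.edist o u = ((k + 1 : ℕ) : ℕ∞) ∧ par u = w with hA
  set rk : Fin n → ℕ := fun x => (A.filter fun u => σ u ≤ σ x).card with hrk
  have hlab : ∀ x ∈ A, bfsLabel G o σ x = w ++ [rk x] := by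
    intro x hx
    simp only [hA, Finset.mem_filter, Finset.mem_univ, true_and] at hx
    rw [bfsLabel_of_dist G o σ hx.1, levelLabel]
    simp only [← hpar, hx.2]
    congr 2
    simp only [hrk, hA, Finset.filter_filter, and_assoc]
  have hvA : v ∈ A := by simp [hA, hd, hp]
  have hreach : ∀ x ∈ A, G.Reachable o x := by
    intro x hx
    simp only [hA, Finset.mem_filter, Finset.mem_univ, true_and] at hx
    exact reachable_of_edist G o hx.1
  have hj : rk v = j := by
    have := hlab v hvA
    rw [h] at this
    simpa using (List.append_inj' this rfl).2.symm
  have hmaps : ∀ x ∈ A, rk x ∈ Finset.Icc 1 A.card := by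
    intro x hx
    rw [Finset.mem_Icc]
    exact ⟨Finset.card_pos.2 ⟨x, by simp [hx]⟩, Finset.card_le_card (Finset.filter_subset _ _)⟩
  have hinj : Set.InjOn rk A := by
    intro x hx y hy hxy
    refine bfsLabel_inj G o σ (hreach x hx) (hreach y hy) ?_
    rw [hlab x hx, hlab y hy, hxy]
  have hsurj : A.image rk = Finset.Icc 1 A.card := by
    refine Finset.eq_of_subset_of_card_le (Finset.image_subset_iff.2 hmaps) ?_
    rw [Finset.card_image_of_injOn hinj]
    simp
  have hjm := Finset.mem_Icc.1 (hmaps v hvA)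
  rw [hj] at hjm
  refine ⟨hjm.1, fun i h1 h2 => ?_⟩
  have : i ∈ A.image rk := by
    rw [hsurj, Finset.mem_Icc]
    exact ⟨h1, h2.trans hjm.2⟩
  obtain ⟨u, hu, rfl⟩ := Finset.mem_image.1 this
  exact ⟨u, hreach u hu, hlab u hu⟩

open Classical in
/-- The connected component of `o` in the colored graph `(G, f)`, rooted at `o` and labeled by the
breadth-first search in which ties are broken by the order `σ`. -/
noncomputable def bfsGraph {M : Type*} (f : Fin n → M) : RootedGraph M where
  graph :=
    { Adj := fun a b => ∃ u v, G.Reachable o u ∧ G.Adj u v ∧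
        bfsLabel G o σ u = a ∧ bfsLabel G o σ v = b
      symm := ⟨by
        rintro a b ⟨u, v, h1, h2, h3, h4⟩
        exact ⟨v, u, h1.trans h2.reachable, h2.symm, h4, h3⟩⟩
      loopless := ⟨by
        rintro a ⟨u, v, h1, h2, h3, h4⟩
        exact h2.ne (bfsLabel_inj G o σ h1 (h1.trans h2.reachable) (h3.trans h4.symm))⟩ }
  color := fun a =>
    if h : ∃ u, G.Reachable o u ∧ bfsLabel G o σ u = a then some (f h.choose) else none
  root_mem := by
    have : ∃ u, G.Reachable o u ∧ bfsLabel G o σ u = [] :=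
      ⟨o, SimpleGraph.Reachable.refl _, by simp [bfsLabel, levelLabel]⟩
    simp [this]
  adj_mem := by
    rintro a b ⟨u, v, h1, -, h3, -⟩
    have : ∃ u, G.Reachable o u ∧ bfsLabel G o σ u = a := ⟨u, h1, h3⟩
    simp [this]
  locally_finite := by
    intro a
    refine (Set.finite_range (bfsLabel G o σ)).subset ?_
    rintro b ⟨u, v, -, -, -, h⟩
    exact ⟨v, h⟩
  parent_adj := by
    intro w j h
    have h' : ∃ u, G.Reachable o u ∧ bfsLabel G o σ u = w ++ [j] := by
      by_contra hc
      simp [hc] at h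
    obtain ⟨v, hv, hl⟩ := h'
    obtain ⟨⟨u, h1, h2, h3⟩, -⟩ := parentLabel_spec G o (levelLabel G o σ w.length)
      (edist_of_label G o σ hv hl)
    refine ⟨u, v, reachable_of_edist G o h1, h2, ?_, hl⟩
    rw [bfsLabel_of_dist G o σ h1, h3, parent_of_label G o σ hv hl]
  parent_first := by
    rintro w j a ⟨u, v, h1, h2, rfl, hl⟩
    have hv := h1.trans h2.reachable
    have hd := edist_of_label G o σ hv hl
    have hlen := length_bfsLabel G o σ h1
    have htri : G.edist o v ≤ G.edist o u + 1 := by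
      refine (SimpleGraph.edist_triangle (v := u)).trans ?_
      gcongr
      exact (SimpleGraph.edist_eq_one_iff_adj.2 h2).le
    rw [hd, ← h1.coe_dist_eq_edist] at htri
    norm_cast at htri
    rcases Nat.lt_or_ge w.length (G.dist o u) with hlt | hge
    · left
      rw [hlen]
      exact hlt
    · have he : G.dist o u = w.length := by omega
      right
      refine ⟨by rw [hlen, he], ?_⟩
      have heu : G.edist o u = w.length := by rw [← h1.coe_dist_eq_edist, he]
      have := (parentLabel_spec G o (levelLabel G o σ w.length) hd).2 u heu h2
      rw [parent_of_label G o σ hv hl] at this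
      rwa [bfsLabel_of_dist G o σ heu]
  siblings := by
    intro w j h
    have h' : ∃ u, G.Reachable o u ∧ bfsLabel G o σ u = w ++ [j] := by
      by_contra hc
      simp [hc] at h
    obtain ⟨v, hv, hl⟩ := h'
    obtain ⟨h1, h2⟩ := siblings_of_label G o σ hv hl
    refine ⟨h1, fun i hi hij => ?_⟩
    simp [h2 i hi hij]

end BFS

/-- The law of the randomly labeled rooted graph of a vertex `v` of the colored graph `(G, f)`: the
breadth-first search started at `v`, with ties broken by a uniformly random order. -/
noncomputable def distrAt {M : Type*} {n : ℕ} (G : SimpleGraph (Fin n)) (f : Fin n → M)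
    (v : Fin n) : PMF (RootedGraph M) :=
  (PMF.uniformOfFintype (Equiv.Perm (Fin n))).map fun σ => bfsGraph G v σ f

/-- The average over the vertices `v` of the laws of the randomly labeled graphs rooted at `v`. -/
noncomputable def distr {M : Type*} {n : ℕ} [NeZero n] (G : SimpleGraph (Fin n))
    (f : Fin n → M) : ProbabilityMeasure (RootedGraph M) :=
  ⟨((PMF.uniformOfFintype (Fin n)).bind (distrAt G f)).toMeasure, inferInstance⟩

/-! ## Invariant processes on the infinite regular tree -/

/-- The vertices of the infinite `d`-regular tree: the first entry of a sequence is in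
`{1, …, d}` and the other ones in `{1, …, d - 1}`. -/
def treeVerts (d : ℕ) : Set (List ℕ) :=
  {w | (∀ i ∈ w, 1 ≤ i) ∧ (∀ i ∈ w.head?, i ≤ d) ∧ ∀ i ∈ w.tail, i ≤ d - 1}

/-- The infinite `d`-regular tree: a sequence is adjacent to its one-term extensions. -/
def regularTree (d : ℕ) : SimpleGraph (treeVerts d) where
  Adj a b := ∃ j, b.1 = a.1 ++ [j] ∨ a.1 = b.1 ++ [j]
  symm := ⟨fun _ _ ⟨j, h⟩ => ⟨j, h.symm⟩⟩
  loopless := ⟨by rintro a ⟨j, h | h⟩ <;> simp at h⟩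

/-- A probability measure on `M ^ T_d` which is invariant by all automorphisms of the tree `T_d`. -/
def IsInvariant {M : Type*} [MeasurableSpace M] {d : ℕ}
    (μ : ProbabilityMeasure (treeVerts d → M)) : Prop :=
  ∀ φ : regularTree d ≃g regularTree d,
    (μ : Measure (treeVerts d → M)).map (fun x v => x (φ v)) = μ

theorem treeVerts_parent {d : ℕ} {w : List ℕ} {j : ℕ} (h : w ++ [j] ∈ treeVerts d) :
    w ∈ treeVerts d := by
  obtain ⟨h1, h2, h3⟩ := h
  cases w with
  | nil => simp [treeVerts]
  | cons a t =>
    refine ⟨fun i hi => h1 i (by simp at hi ⊢; tauto), by simpa using h2, fun i hi => h3 i ?_⟩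
    simp at hi ⊢
    tauto

theorem treeVerts_sibling {d : ℕ} {w : List ℕ} {j : ℕ} (h : w ++ [j] ∈ treeVerts d) :
    1 ≤ j ∧ j ≤ d ∧ ∀ i, 1 ≤ i → i ≤ j → w ++ [i] ∈ treeVerts d := by
  obtain ⟨h1, h2, h3⟩ := h
  cases w with
  | nil =>
    simp at h1 h2
    refine ⟨h1, h2, fun i hi hij => ?_⟩
    simp [treeVerts]
    omega
  | cons a t =>
    simp at h1 h2 h3
    have hj : j ≤ d - 1 := h3 j (Or.inr rfl)
    refine ⟨h1.2 j (Or.inr rfl), by omega, fun i hi hij => ?_⟩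
    refine ⟨?_, by simpa using h2, ?_⟩
    · simp only [List.cons_append, List.mem_cons, List.mem_append, List.not_mem_nil, or_false]
      rintro x (rfl | hx | rfl)
      · exact h1.1
      · exact h1.2 x (Or.inl hx)
      · exact hi
    · simp only [List.cons_append, List.tail_cons, List.mem_append, List.mem_cons,
        List.not_mem_nil, or_false]
      rintro x (hx | rfl)
      · exact h3 x (Or.inl hx)
      · omega

open Classical in
/-- The rooted colored graph `(T_d, x, o)`. -/
noncomputable def treeGraph {M : Type*} (d : ℕ) (x : treeVerts d → M) : RootedGraph M where
  graph := (regularTree d).map (Function.Embedding.subtype _)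
  color := fun w => if h : w ∈ treeVerts d then some (x ⟨w, h⟩) else none
  root_mem := by
    have : ([] : List ℕ) ∈ treeVerts d := by simp [treeVerts]
    simp [this]
  adj_mem := by
    rintro u v h
    rw [SimpleGraph.map_adj] at h
    obtain ⟨a, b, -, rfl, -⟩ := h
    simp
  locally_finite := by
    intro u
    refine ((Set.finite_singleton u.dropLast).union
      ((Set.finite_Iic d).image fun j => u ++ [j])).subset ?_
    rintro v h
    rw [SimpleGraph.mem_neighborSet, SimpleGraph.map_adj] at h
    obtain ⟨a, b, ⟨j, h | h⟩, rfl, rfl⟩ := h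
    · right
      refine ⟨j, ?_, h.symm⟩
      have hb := b.2
      rw [h] at hb
      exact (treeVerts_sibling hb).2.1
    · left
      simp [h]
  parent_adj := by
    intro w j h
    have hm : w ++ [j] ∈ treeVerts d := by
      by_contra hc
      simp [hc] at h
    rw [SimpleGraph.map_adj]
    exact ⟨⟨w, treeVerts_parent hm⟩, ⟨_, hm⟩, ⟨j, Or.inl rfl⟩, rfl, rfl⟩
  parent_first := by
    intro w j u h
    rw [SimpleGraph.map_adj] at h
    obtain ⟨a, b, ⟨i, h | h⟩, rfl, hb⟩ := h
    · right
      have hb' : b.1 = w ++ [j] := hb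
      rw [hb'] at h
      have := (List.append_inj' h rfl).1
      subst this
      exact ⟨rfl, le_refl _⟩
    · left
      have hb' : b.1 = w ++ [j] := hb
      have : a.1 = w ++ [j] ++ [i] := by rw [h, hb']
      change w.length < a.1.length
      rw [this]
      simp
  siblings := by
    intro w j h
    have hm : w ++ [j] ∈ treeVerts d := by
      by_contra hc
      simp [hc] at h
    obtain ⟨h1, -, h2⟩ := treeVerts_sibling hm
    exact ⟨h1, fun i hi hij => by simp [h2 i hi hij]⟩

theorem finite_treeVerts_le (d r : ℕ) : {v : treeVerts d | v.1.length ≤ r}.Finite := by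
  have h : {w : List ℕ | w.length ≤ r ∧ ∀ i ∈ w, i ≤ d}.Finite := by
    have h0 := List.finite_length_le (Fin (d + 1)) r
    refine (h0.image (List.map Fin.val)).subset ?_
    rintro w ⟨hw, hi⟩
    refine ⟨w.pmap (fun i h => (⟨i, Nat.lt_succ_of_le h⟩ : Fin (d + 1))) hi, by simpa using hw, ?_⟩
    simp [List.map_pmap]
  refine Set.Finite.of_finite_image (f := Subtype.val) (h.subset ?_)
    Subtype.val_injective.injOn
  rintro w ⟨v, hv, rfl⟩
  refine ⟨hv, fun i hi => ?_⟩
  obtain ⟨-, h2, h3⟩ := v.2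
  cases hw : v.1 with
  | nil => simp [hw] at hi
  | cons a t =>
    rw [hw] at h2 h3 hi
    simp at h2 h3 hi
    rcases hi with rfl | hi
    · exact h2
    · exact (h3 i hi).trans (Nat.sub_le _ _)

theorem measurable_treeGraph {M : Type*} [Finite M] [MeasurableSpace M]
    [MeasurableSingletonClass M] (d : ℕ) :
    Measurable (treeGraph d : (treeVerts d → M) → RootedGraph M) := by
  have hr : ∀ r : ℕ, Measurable fun x : treeVerts d → M => (treeGraph d x).trunc r := by
    intro r
    have : Finite {v : treeVerts d | v.1.length ≤ r} := finite_treeVerts_le d r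
    rcases isEmpty_or_nonempty M with hM | hM
    · have : IsEmpty (treeVerts d → M) := ⟨fun x => hM.elim (x ⟨[], by simp [treeVerts]⟩)⟩
      exact measurable_of_empty _
    classical
    let m : M := hM.some
    let F : ({v : treeVerts d | v.1.length ≤ r} → M) → RootedGraph M := fun y =>
      (treeGraph d fun v => if h : v.1.length ≤ r then y ⟨v, h⟩ else m).trunc r
    have hF : (fun x : treeVerts d → M => (treeGraph d x).trunc r) =
        F ∘ fun x v => x v.1 := by
      funext x
      ext u v
      · rfl
      · simp only [F, RootedGraph.trunc, treeGraph, Function.comp]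
        by_cases hu : u.length ≤ r
        · simp [hu]
        · simp [hu]
    rw [hF]
    exact (measurable_of_finite F).comp (measurable_pi_lambda _ fun v => measurable_pi_apply _)
  refine measurable_of_tendsto_metrizable hr ?_
  rw [tendsto_pi_nhds]
  intro x
  rw [tendsto_iff_dist_tendsto_zero]
  exact squeeze_zero (fun _ => dist_nonneg) (fun r => RootedGraph.dist_trunc_le _ r)
    (tendsto_pow_atTop_nhds_zero_of_lt_one (by norm_num) (by norm_num))

/-- The law of `(T_d, X, o)`, where `X` has law `μ`. -/
noncomputable def treeLaw {M : Type*} [Finite M] [MeasurableSpace M] [MeasurableSingletonClass M]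
    {d : ℕ} (μ : ProbabilityMeasure (treeVerts d → M)) : ProbabilityMeasure (RootedGraph M) :=
  μ.map (measurable_treeGraph d).aemeasurable

/-! ## Distances on probability measures -/

/-- `D` is a distance on the probability measures on `X` which generates the weak topology. -/
structure GeneratesWeakTopology {X : Type*} [TopologicalSpace X] [MeasurableSpace X]
    [OpensMeasurableSpace X] (D : ProbabilityMeasure X → ProbabilityMeasure X → ℝ) : Prop where
  eq_zero_iff : ∀ ρ ρ', D ρ ρ' = 0 ↔ ρ = ρ'
  symm : ∀ ρ ρ', D ρ ρ' = D ρ' ρ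
  triangle : ∀ ρ ρ' ρ'', D ρ ρ'' ≤ D ρ ρ' + D ρ' ρ''
  nhds_basis : ∀ ρ, (𝓝 ρ).HasBasis (fun ε : ℝ => 0 < ε) fun ε => {ρ' | D ρ' ρ < ε}

/-- `D` is at most a constant times the total variation distance. -/
def BoundedByTotalVariation {X : Type*} [MeasurableSpace X]
    (D : ProbabilityMeasure X → ProbabilityMeasure X → ℝ) : Prop :=
  ∃ C : ℝ, ∀ (ρ ρ' : ProbabilityMeasure X) (t : ℝ),
    (∀ A : Set X, MeasurableSet A →
      |(ρ : Measure X).real A - (ρ' : Measure X).real A| ≤ t) → D ρ ρ' ≤ C * t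

/-! ## Entropy of random regular graphs -/

/-- The set of simple `d`-regular graphs on a set of `n` vertices. -/
def regularGraphs (d n : ℕ) : Set (SimpleGraph (Fin n)) :=
  {G | ∀ v, (G.neighborSet v).ncard = d}

/-- The probability that a uniformly distributed `d`-regular graph on `n` vertices is in `A`. -/
noncomputable def graphProb (d n : ℕ) (A : Set (SimpleGraph (Fin n))) : ℝ≥0∞ :=
  ((regularGraphs d n ∩ A).ncard : ℝ≥0∞) / ((regularGraphs d n).ncard : ℝ≥0∞)

/-- `n` tends to infinity along the integers `n ≥ d + 1` such that `n d` is even. -/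
def sizes (d : ℕ) : Filter ℕ := atTop ⊓ 𝓟 {n | d + 1 ≤ n ∧ Even (n * d)}

/-- The possible values `{-∞} ∪ [0, ∞)` of the entropies. -/
def entropyRange : Set EReal := {h | h = ⊥ ∨ (0 ≤ h ∧ h < ⊤)}

section Entropy

variable {M : Type*} [Finite M] [MeasurableSpace M] [MeasurableSingletonClass M] {d : ℕ}
  (D : ProbabilityMeasure (RootedGraph M) → ProbabilityMeasure (RootedGraph M) → ℝ)
  (μ : ProbabilityMeasure (treeVerts d → M)) (r : ℕ)

/-- The colorings `f` of `G` such that the restrictions to radius `r` of `distr_G(f)` and `μ` are at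
distance at most `ε` (there is none if `n = 0`, where `distr_G(f)` makes no sense). -/
def colorings {n : ℕ} (G : SimpleGraph (Fin n)) (ε : ℝ) : Set (Fin n → M) :=
  {f | ∃ _ : NeZero n, D (restr r (distr G f)) (restr r (treeLaw μ)) ≤ ε}

/-- `H_G(μ, r, ε)`, with the convention `log 0 = -∞`. -/
noncomputable def entropyH {n : ℕ} (G : SimpleGraph (Fin n)) (ε : ℝ) : EReal :=
  ENNReal.log ((colorings D μ r G ε).ncard : ℝ≥0∞) / (n : EReal)

/-- The median value `h_n(μ, r, ε, α)`. -/
noncomputable def medianEntropy (n : ℕ) (ε α : ℝ) : EReal :=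
  sSup {h | h ∈ entropyRange ∧
    ENNReal.ofReal α ≤ graphProb d n {G | h ≤ entropyH D μ r G ε}}

/-- The upper entropy. The quantity is non-decreasing in `ε`, so that the infimum over `ε > 0` is
the limit as `ε → 0`, see `tendsto_upperEntropy`. -/
noncomputable def upperEntropy (α : ℝ) : EReal :=
  ⨅ ε ∈ Ioi (0 : ℝ), limsup (fun n => medianEntropy D μ r n ε α) (sizes d)

/-- The lower entropy, see `tendsto_lowerEntropy`. -/
noncomputable def lowerEntropy (α : ℝ) : EReal :=
  ⨅ ε ∈ Ioi (0 : ℝ), liminf (fun n => medianEntropy D μ r n ε α) (sizes d)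

theorem medianEntropy_mono (n : ℕ) (α : ℝ) : Monotone fun ε => medianEntropy D μ r n ε α := by
  intro ε ε' h
  refine sSup_le_sSup ?_
  rintro x ⟨hx, hp⟩
  refine ⟨hx, hp.trans ?_⟩
  unfold graphProb
  gcongr
  · exact Set.toFinite _
  · unfold entropyH
    refine EReal.div_le_div_right_of_nonneg (by positivity) (ENNReal.log_monotone ?_)
    have hsub : colorings D μ r G ε ⊆ colorings D μ r G ε' := fun f ⟨hn, hf⟩ => ⟨hn, hf.trans h⟩
    exact_mod_cast Set.ncard_le_ncard hsub (Set.toFinite _)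

theorem tendsto_upperEntropy (α : ℝ) :
    Tendsto (fun ε => limsup (fun n => medianEntropy D μ r n ε α) (sizes d)) (𝓝[>] 0)
      (𝓝 (upperEntropy D μ r α)) := by
  have h : Monotone fun ε => limsup (fun n => medianEntropy D μ r n ε α) (sizes d) :=
    fun ε ε' hε => limsup_le_limsup (Eventually.of_forall fun n => medianEntropy_mono D μ r n α hε)
  simpa only [upperEntropy, sInf_image] using h.tendsto_nhdsGT 0

theorem tendsto_lowerEntropy (α : ℝ) :
    Tendsto (fun ε => liminf (fun n => medianEntropy D μ r n ε α) (sizes d)) (𝓝[>] 0)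
      (𝓝 (lowerEntropy D μ r α)) := by
  have h : Monotone fun ε => liminf (fun n => medianEntropy D μ r n ε α) (sizes d) :=
    fun ε ε' hε => liminf_le_liminf (Eventually.of_forall fun n => medianEntropy_mono D μ r n α hε)
  simpa only [lowerEntropy, sInf_image] using h.tendsto_nhdsGT 0

/-- The exponential rate `(1 / n) log P(H_{G_n}(μ, r, ε) ≥ h)`. -/
noncomputable def rateGE (h : EReal) (ε : ℝ) (n : ℕ) : EReal :=
  ENNReal.log (graphProb d n {G | h ≤ entropyH D μ r G ε}) / (n : EReal)

/-- The exponential rate `(1 / n) log P(H_{G_n}(μ, r, ε) ≤ h)`. -/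
noncomputable def rateLE (h : EReal) (ε : ℝ) (n : ℕ) : EReal :=
  ENNReal.log (graphProb d n {G | entropyH D μ r G ε ≤ h}) / (n : EReal)

end Entropy

end Sofic

/-! The theorem rests on concentration of measure in the configuration model. A uniform perfect
matching of the `n * d` half-edges is a conjugate `π * m * π⁻¹` of a fixed matching by a uniform
permutation. Revealing the permutation one image at a time, with Hoeffding's lemma at each step,
bounds the exponential moments of Lipschitz functions (`sum_exp_perm_fin_le`). Applied to the
distance to a set, this shows that two sets of matchings at distance `D` have densities with product
at most `exp (-D ^ 2 / (256 * n * d))` (`card_mul_card_le_of_permDist`).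

Each simple `d`-regular graph comes from exactly `d! ^ n` matchings, and a switching argument shows
that a matching is simple with at least polynomially small probability (`card_pairings_le`). The
estimate thus passes to random regular graphs with a polynomial loss: a set of probability at least
`exp (-c * θ ^ 2 * n)` and a set of probability bounded below contain two graphs whose neighborhoods
differ at no more than `θ * n` vertices (`exists_rate_forall_exists_close`). For such graphs, the
radius `r` statistics of every coloring differ by at most `θ * (d + 1) ^ r` in total variation
(`abs_restr_distr_sub_le`). With a slightly larger tolerance, every good coloring of one graph is
therefore good for the other, so the entropies compare.

For the lower bounds, fix the final tolerance, hence `θ`, and then choose `ε₀` so small that `δ ε₀ <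
c * θ ^ 2`: if the entropy is at least `h` with the assumed probability, it cannot be below `h` with
probability `1 - α`. For the upper bounds, the tolerance grows from `ε / 2` to `ε`, which allows
only `θ` of order `ε`; this is why `δ` has to be `o(ε ^ 2)`. Finally, an event of constant
probability has exponential rate zero, so the lower bounds, applied to thresholds below the entropy
at one level `α`, give independence of `α`. -/

namespace Sofic

/-! ### Concentration of measure on the symmetric group -/

section Concentration

/-- The convexity of the exponential function on `[-c, c]`. -/
theorem exp_mul_le_cosh_add {y t c : ℝ} (hc : 0 < c) (hy : |y| ≤ c) :
    Real.exp (t * y) ≤ Real.cosh (c * t) + y / c * Real.sinh (c * t) := by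
  obtain ⟨h1, h2⟩ := abs_le.1 hy
  have ha : 0 ≤ (1 + y / c) / 2 := by
    have : -1 ≤ y / c := by rw [le_div_iff₀ hc]; linarith
    linarith
  have hb : 0 ≤ (1 - y / c) / 2 := by
    have : y / c ≤ 1 := by rw [div_le_iff₀ hc]; linarith
    linarith
  have h := convexOn_exp.2 (mem_univ (c * t)) (mem_univ (-(c * t))) ha hb (by ring)
  simp only [smul_eq_mul] at h
  have he : (1 + y / c) / 2 * (c * t) + (1 - y / c) / 2 * -(c * t) = t * y := by
    field_simp
    ring
  rw [he] at h
  refine h.trans (le_of_eq ?_)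
  rw [Real.cosh_eq, Real.sinh_eq]
  ring

/-- A form of Hoeffding's lemma for averages over a finite type. -/
theorem sum_exp_le_of_abs_sub_le {ι : Type*} [Fintype ι] [Nonempty ι] (x : ι → ℝ) (t : ℝ)
    (hx : ∀ i j, |x i - x j| ≤ 2) :
    ∑ i, Real.exp (t * x i) ≤
      Fintype.card ι * Real.exp (t * ((∑ i, x i) / Fintype.card ι) + 2 * t ^ 2) := by
  set k : ℝ := (Fintype.card ι : ℝ) with hk
  have hk0 : 0 < k := by rw [hk]; exact_mod_cast Fintype.card_pos
  set a : ℝ := (∑ i, x i) / k with ha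
  have hsum : ∑ i, (x i - a) = 0 := by
    rw [Finset.sum_sub_distrib, Finset.sum_const, Finset.card_univ, nsmul_eq_mul, ← hk, ha]
    field_simp
    ring
  have hdev : ∀ i, |x i - a| ≤ 2 := by
    intro i
    have h1 : x i - a = (∑ j, (x i - x j)) / k := by
      rw [Finset.sum_sub_distrib, Finset.sum_const, Finset.card_univ, nsmul_eq_mul, ← hk, ha]
      field_simp
    rw [h1, abs_div, abs_of_pos hk0, div_le_iff₀ hk0]
    refine (Finset.abs_sum_le_sum_abs _ _).trans ?_
    refine (Finset.sum_le_sum fun j _ => hx i j).trans (le_of_eq ?_)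
    rw [Finset.sum_const, Finset.card_univ, nsmul_eq_mul, ← hk, mul_comm]
  calc ∑ i, Real.exp (t * x i)
      = Real.exp (t * a) * ∑ i, Real.exp (t * (x i - a)) := by
        rw [Finset.mul_sum]
        refine Finset.sum_congr rfl fun i _ => ?_
        rw [← Real.exp_add]
        ring_nf
    -- The exponential is bounded by its chord on `[-2, 2]`; the deviations from the mean `a` sum to
    -- zero, so the `sinh` terms cancel.
    _ ≤ Real.exp (t * a) * ∑ i, (Real.cosh (2 * t) + (x i - a) / 2 * Real.sinh (2 * t)) := by
        gcongr with i
        exact exp_mul_le_cosh_add two_pos (hdev i)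
    _ = Real.exp (t * a) * (k * Real.cosh (2 * t)) := by
        rw [Finset.sum_add_distrib, Finset.sum_const, Finset.card_univ, nsmul_eq_mul, ← hk,
          ← Finset.sum_mul, ← Finset.sum_div, hsum]
        ring
    _ ≤ Real.exp (t * a) * (k * Real.exp (2 * t ^ 2)) := by
        gcongr
        refine (Real.cosh_le_exp_half_sq _).trans (le_of_eq ?_)
        ring_nf
    _ = k * Real.exp (t * a + 2 * t ^ 2) := by
        rw [Real.exp_add]
        ring

-- In `decomposeFin`, the first component is the image of `0`. Changing this image costs two
-- transpositions on the left, so a Lipschitz function changes by at most `2`.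
open Equiv Equiv.Perm in
theorem decomposeFin_symm_eq_mul {N : ℕ} (p q : Fin (N + 1)) (e : Perm (Fin N)) :
    decomposeFin.symm (q, e) = swap 0 q * (swap 0 p * decomposeFin.symm (p, e)) := by
  ext i : 1
  refine Fin.cases ?_ (fun j => ?_) i <;> simp

-- This makes the Lipschitz condition pass to the permutations with a prescribed image of `0`, as
-- the induction on `N` requires: a transposition of the remaining part is again a transposition of
-- the whole, conjugated by `swap 0 p`.
open Equiv Equiv.Perm in
theorem decomposeFin_symm_swap_mul {N : ℕ} (p : Fin (N + 1)) (x y : Fin N) (e : Perm (Fin N)) :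
    decomposeFin.symm (p, swap x y * e) =
      swap (swap 0 p x.succ) (swap 0 p y.succ) * decomposeFin.symm (p, e) := by
  have h : decomposeFin.symm (0, swap x y * e) =
      swap x.succ y.succ * decomposeFin.symm (0, e) := by
    ext i : 1
    refine Fin.cases ?_ (fun j => ?_) i
    · simp [swap_apply_of_ne_of_ne, Fin.succ_ne_zero, Ne.symm]
    · simp [(Fin.succ_injective N).map_swap]
  rw [decomposeFin_symm_eq_mul 0 p (swap x y * e), decomposeFin_symm_eq_mul 0 p e, h,
    swap_apply_apply]
  simp only [swap_self, swap_inv, mul_assoc, swap_mul_self_mul]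
  rfl

open Equiv Equiv.Perm in
/-- Concentration of measure for functions on the symmetric group which are Lipschitz with respect
to multiplication by transpositions. -/
theorem sum_exp_perm_fin_le {N : ℕ} (F : Perm (Fin N) → ℝ)
    (hF : ∀ x y π, |F (swap x y * π) - F π| ≤ 1) (t : ℝ) :
    ∑ π, Real.exp (t * F π) ≤
      Nat.factorial N * Real.exp (t * ((∑ π, F π) / Nat.factorial N) + 2 * t ^ 2 * N) := by
  induction N with
  | zero => simp
  | succ N ih =>
    -- The conditional mean of `F` given that `0` is sent to `p`. These means differ by at most `2`,
    -- so revealing one image adds `2 * t ^ 2` to the exponent.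
    set x : Fin (N + 1) → ℝ := fun p =>
      (∑ e, F (decomposeFin.symm (p, e))) / Nat.factorial N with hx
    have hfac : (0 : ℝ) < Nat.factorial N := by positivity
    have hsplit : ∀ g : Perm (Fin (N + 1)) → ℝ,
        ∑ π, g π = ∑ p, ∑ e, g (decomposeFin.symm (p, e)) := by
      intro g
      rw [← Fintype.sum_prod_type', ← decomposeFin.symm.sum_comp]
    have hxx : ∀ p q, |x p - x q| ≤ 2 := by
      intro p q
      simp only [hx]
      rw [← sub_div, ← Finset.sum_sub_distrib, abs_div, abs_of_pos hfac, div_le_iff₀ hfac]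
      refine (Finset.abs_sum_le_sum_abs _ _).trans ?_
      refine (Finset.sum_le_sum (g := fun _ => (2 : ℝ)) fun e _ => ?_).trans (le_of_eq ?_)
      · rw [decomposeFin_symm_eq_mul q p e]
        have h1 := hF 0 p (swap 0 q * decomposeFin.symm (q, e))
        have h2 := hF 0 q (decomposeFin.symm (q, e))
        rw [abs_le] at h1 h2 ⊢
        constructor <;> linarith
      · rw [Finset.sum_const, Finset.card_univ, Fintype.card_perm, Fintype.card_fin]
        simp [mul_comm]
    have hmean : (∑ p, x p) / ((N + 1 : ℕ) : ℝ) = (∑ π, F π) / Nat.factorial (N + 1) := by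
      simp only [hx]
      rw [← Finset.sum_div, ← hsplit, Nat.factorial_succ]
      push_cast
      field_simp
    have hH := sum_exp_le_of_abs_sub_le x t hxx
    rw [Fintype.card_fin, hmean] at hH
    calc ∑ π, Real.exp (t * F π)
        = ∑ p, ∑ e, Real.exp (t * F (decomposeFin.symm (p, e))) := hsplit _
      _ ≤ ∑ p, Nat.factorial N * Real.exp (t * x p + 2 * t ^ 2 * N) := by
          refine Finset.sum_le_sum fun p _ => ih (fun e => F (decomposeFin.symm (p, e))) ?_
          intro a b e
          rw [decomposeFin_symm_swap_mul]
          exact hF _ _ _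
      _ = Nat.factorial N * Real.exp (2 * t ^ 2 * N) * ∑ p, Real.exp (t * x p) := by
          rw [Finset.mul_sum]
          refine Finset.sum_congr rfl fun p _ => ?_
          rw [Real.exp_add]
          ring
      _ ≤ Nat.factorial N * Real.exp (2 * t ^ 2 * N) * (((N + 1 : ℕ) : ℝ) *
            Real.exp (t * ((∑ π, F π) / Nat.factorial (N + 1)) + 2 * t ^ 2)) := by
          gcongr
      _ = _ := by
          rw [Nat.factorial_succ]
          push_cast
          rw [show t * ((∑ π, F π) / ((N + 1) * Nat.factorial N)) + 2 * t ^ 2 * ((N : ℝ) + 1) =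
            2 * t ^ 2 * N + (t * ((∑ π, F π) / ((N + 1) * Nat.factorial N)) + 2 * t ^ 2) by ring,
            Real.exp_add (2 * t ^ 2 * N)]
          ring

end Concentration

/-! ### Concentration for perfect matchings -/

section Pairings

open Equiv Equiv.Perm

variable {H : Type*} [Fintype H] [DecidableEq H]

theorem sum_exp_perm_le (F : Perm H → ℝ) (hF : ∀ x y π, |F (swap x y * π) - F π| ≤ 1) (t : ℝ) :
    ∑ π, Real.exp (t * F π) ≤ Nat.factorial (Fintype.card H) *
      Real.exp (t * ((∑ π, F π) / Nat.factorial (Fintype.card H)) +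
        2 * t ^ 2 * Fintype.card H) := by
  let e : Perm (Fin (Fintype.card H)) ≃ Perm H := (Fintype.equivFin H).symm.permCongr
  have h := sum_exp_perm_fin_le (fun π => F (e π)) (by
    intro x y π
    have : e (swap x y * π) = swap ((Fintype.equivFin H).symm x) ((Fintype.equivFin H).symm y) *
        e π := by
      ext i
      simp only [e, permCongr_apply, coe_mul, Function.comp_apply]
      exact (Fintype.equivFin H).symm.injective.map_swap _ _ _
    rw [this]
    exact hF _ _ _) t
  rwa [e.sum_comp fun π => Real.exp (t * F π), e.sum_comp F] at h

variable (H) in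
/-- The perfect matchings of `H`, as involutions without fixed points. -/
def pairings : Finset (Perm H) :=
  Finset.univ.filter fun m => (∀ x, m (m x) = x) ∧ ∀ x, m x ≠ x

theorem mem_pairings {m : Perm H} : m ∈ pairings H ↔ (∀ x, m (m x) = x) ∧ ∀ x, m x ≠ x := by
  simp [pairings]

theorem conj_mem_pairings {m : Perm H} (hm : m ∈ pairings H) (g : Perm H) :
    g * m * g⁻¹ ∈ pairings H := by
  rw [mem_pairings] at hm ⊢
  refine ⟨fun x => by simp [hm.1], fun x h => hm.2 (g⁻¹ x) ?_⟩
  simp only [coe_mul, Function.comp_apply] at h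
  rw [eq_inv_iff_eq, h]

/-- A fixed-point-free involution is a product of disjoint transpositions covering everything. All
perfect matchings therefore have the same cycle type and form a single conjugacy class. -/
theorem cycleType_of_mem_pairings {m : Perm H} (hm : m ∈ pairings H) :
    m.cycleType = Multiset.replicate (Fintype.card H / 2) 2 := by
  rw [mem_pairings] at hm
  have h2 : ∀ k ∈ m.cycleType, k = 2 := by
    intro k hk
    have h1 := two_le_of_mem_cycleType hk
    have h3 : m ^ 2 = 1 := by
      ext x
      simp [pow_two, hm.1]
    exact le_antisymm (Nat.le_of_dvd two_pos
      ((dvd_of_mem_cycleType hk).trans (orderOf_dvd_of_pow_eq_one h3))) h1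
  have hs : m.support = Finset.univ := by
    ext x
    simp [hm.2]
  have hsum := sum_cycleType m
  rw [hs, Finset.card_univ, Multiset.eq_replicate_card.2 h2, Multiset.sum_replicate] at hsum
  rw [Multiset.eq_replicate]
  refine ⟨?_, h2⟩
  simp at hsum
  omega

theorem isConj_of_mem_pairings {m m' : Perm H} (hm : m ∈ pairings H) (hm' : m' ∈ pairings H) :
    IsConj m m' := by
  rw [isConj_iff_cycleType_eq, cycleType_of_mem_pairings hm, cycleType_of_mem_pairings hm']

/-- The conjugates of a perfect matching by a uniform permutation are uniformly distributed. -/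
theorem card_mul_sum_conj {m : Perm H} (hm : m ∈ pairings H) (g : Perm H → ℝ) :
    (pairings H).card * ∑ π : Perm H, g (π * m * π⁻¹) =
      Nat.factorial (Fintype.card H) * ∑ m' ∈ pairings H, g m' := by
  have h1 : ∀ m' ∈ pairings H, ∑ π : Perm H, g (π * m' * π⁻¹) = ∑ π : Perm H, g (π * m * π⁻¹) := by
    intro m' hm'
    obtain ⟨c, hc⟩ := isConj_iff.1 (isConj_of_mem_pairings hm hm')
    rw [← Equiv.sum_comp (Equiv.mulRight c) fun π => g (π * m * π⁻¹)]
    refine Finset.sum_congr rfl fun π _ => ?_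
    rw [← hc]
    simp [mul_assoc]
  have h2 : ∀ π : Perm H, ∑ m' ∈ pairings H, g (π * m' * π⁻¹) = ∑ m' ∈ pairings H, g m' := by
    intro π
    refine Finset.sum_bij' (fun m' _ => π * m' * π⁻¹) (fun m' _ => π⁻¹ * m' * π)
      (fun m' h => conj_mem_pairings h π)
      (fun m' h => by simpa using conj_mem_pairings h π⁻¹) ?_ ?_ ?_ <;> simp [mul_assoc]
  have h3 := Finset.sum_comm (s := pairings H) (t := (Finset.univ : Finset (Perm H)))
    (f := fun m' π => g (π * m' * π⁻¹))
  rw [Finset.sum_congr rfl h1, Finset.sum_congr rfl fun π _ => h2 π] at h3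
  simpa [Fintype.card_perm] using h3

/-- Multiplying `π` on the left by a transposition conjugates `π * m * π⁻¹` by it, so `F` pulls back
to a Lipschitz function on the symmetric group. The value of `E`, a mean, is irrelevant later; what
matters is that it does not depend on `t`. -/
theorem sum_exp_pairings_le (F : Perm H → ℝ)
    (hF : ∀ x y m, |F (swap x y * m * swap x y) - F m| ≤ 1) :
    ∃ E : ℝ, ∀ t : ℝ, ∑ m ∈ pairings H, Real.exp (t * F m) ≤
      (pairings H).card * Real.exp (t * E + 2 * t ^ 2 * Fintype.card H) := by
  rcases (pairings H).eq_empty_or_nonempty with he | ⟨m, hm⟩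
  · exact ⟨0, fun t => by simp [he]⟩
  refine ⟨(∑ π : Perm H, F (π * m * π⁻¹)) / Nat.factorial (Fintype.card H), fun t => ?_⟩
  have h := sum_exp_perm_le (fun π => F (π * m * π⁻¹)) (by
    intro x y π
    have := hF x y (π * m * π⁻¹)
    simpa [mul_assoc] using this) t
  have hfac : (0 : ℝ) < Nat.factorial (Fintype.card H) := by positivity
  have h2 := card_mul_sum_conj hm fun m => Real.exp (t * F m)
  refine le_of_mul_le_mul_left ?_ hfac
  rw [← h2]
  calc _ ≤ ((pairings H).card : ℝ) * (Nat.factorial (Fintype.card H) *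
        Real.exp (t * ((∑ π, F (π * m * π⁻¹)) / Nat.factorial (Fintype.card H)) +
        2 * t ^ 2 * Fintype.card H)) := by gcongr
    _ = _ := by ring

/-- The number of points at which two permutations differ. -/
def permDist (a b : Perm H) : ℕ := (Finset.univ.filter fun x => a x ≠ b x).card

theorem permDist_triangle (a b c : Perm H) : permDist a c ≤ permDist a b + permDist b c := by
  refine (Finset.card_le_card ?_).trans (Finset.card_union_le _ _)
  intro x
  simp only [Finset.mem_filter, Finset.mem_univ, true_and, Finset.mem_union]
  intro h
  by_contra! hc
  exact h (hc.1.trans hc.2)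

theorem permDist_comm (a b : Perm H) : permDist a b = permDist b a := by
  simp [permDist, ne_comm]

/-- A change can occur only at `p`, `q` and their preimages. Hence a quarter of the distance to a
set satisfies the Lipschitz condition of `sum_exp_pairings_le`. -/
theorem permDist_swap_conj (m : Perm H) (p q : H) :
    permDist m (swap p q * m * swap p q) ≤ 4 := by
  refine (Finset.card_le_card (t := {p, q, m⁻¹ p, m⁻¹ q}) ?_).trans Finset.card_le_four
  intro x hx
  replace hx : m x ≠ swap p q (m (swap p q x)) := (Finset.mem_filter.1 hx).2
  simp only [Finset.mem_insert, Finset.mem_singleton, eq_inv_iff_eq]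
  by_contra! hc
  obtain ⟨h1, h2, h3, h4⟩ := hc
  rw [swap_apply_of_ne_of_ne h1 h2, swap_apply_of_ne_of_ne h3 h4] at hx
  exact hx rfl

/-- Two sets of perfect matchings which are far apart cannot both be large. -/
theorem card_mul_card_le_of_permDist {A B : Finset (Perm H)} (hA : A ⊆ pairings H)
    (hB : B ⊆ pairings H) {D : ℝ} (hD : ∀ a ∈ A, ∀ b ∈ B, D ≤ permDist a b) (hD0 : 0 ≤ D) :
    (A.card : ℝ) * B.card ≤
      (pairings H).card ^ 2 * Real.exp (-(D ^ 2 / (256 * Fintype.card H))) := by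
  rcases A.eq_empty_or_nonempty with rfl | hne
  · simp only [Finset.card_empty, Nat.cast_zero, zero_mul]
    positivity
  -- If `H` is empty, division by zero makes the exponent `0`, and the bound is the trivial one.
  rcases (Fintype.card H).eq_zero_or_pos with h0 | hpos
  · simp only [h0, Nat.cast_zero, mul_zero, div_zero, neg_zero, Real.exp_zero, mul_one, pow_two]
    gcongr
  set F : Perm H → ℝ := fun m => (A.inf' hne fun a => permDist a m : ℕ) / 4 with hFdef
  have hlip : ∀ m m', permDist m m' ≤ 4 → F m' ≤ F m + 1 := by
    intro m m' h
    obtain ⟨a, ha, hae⟩ := A.exists_mem_eq_inf' hne fun a => permDist a m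
    have h1 : (A.inf' hne fun a => permDist a m') ≤ (A.inf' hne fun a => permDist a m) + 4 := by
      refine (Finset.inf'_le _ ha).trans ?_
      rw [hae]
      exact (permDist_triangle a m m').trans (by gcongr)
    have h2 : ((A.inf' hne fun a => permDist a m' : ℕ) : ℝ) ≤
      (A.inf' hne fun a => permDist a m : ℕ) + 4 := by exact_mod_cast h1
    simp only [hFdef]
    linarith
  obtain ⟨E, hE⟩ := sum_exp_pairings_le F (by
    intro x y m
    have h1 := hlip m _ (permDist_swap_conj m x y)
    have h2 := hlip _ m ((permDist_comm _ _).trans_le (permDist_swap_conj m x y))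
    rw [abs_le]
    constructor <;> linarith)
  have hN : (0 : ℝ) < Fintype.card H := by exact_mod_cast hpos
  set N : ℝ := (Fintype.card H : ℝ) with hNdef
  -- The minimizer of `4 * t ^ 2 * N - t * (D / 4)`. Since `F` vanishes on `A` and is at least `D /
  -- 4` on `B`, the moment bounds at `-t` and `t` control the two cardinalities, and the unknown `E`
  -- cancels in their product.
  set t : ℝ := D / (32 * N) with ht
  have ht0 : 0 ≤ t := by positivity
  have h1 : (A.card : ℝ) ≤ (pairings H).card * Real.exp (-t * E + 2 * (-t) ^ 2 * N) := by
    refine le_trans ?_ (hE (-t))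
    calc (A.card : ℝ) = ∑ m ∈ A, Real.exp (-t * F m) := by
          rw [Finset.sum_congr rfl (g := fun _ => (1 : ℝ)), Finset.sum_const, nsmul_eq_mul, mul_one]
          intro m hm
          have : A.inf' hne (fun a => permDist a m) = 0 := by
            have := Finset.inf'_le (fun a => permDist a m) hm
            simpa [permDist] using this
          simp only [hFdef, this]
          simp
      _ ≤ _ := Finset.sum_le_sum_of_subset_of_nonneg hA fun _ _ _ => (Real.exp_pos _).le
  have h2 : (B.card : ℝ) * Real.exp (t * (D / 4)) ≤
      (pairings H).card * Real.exp (t * E + 2 * t ^ 2 * N) := by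
    refine le_trans ?_ (hE t)
    calc (B.card : ℝ) * Real.exp (t * (D / 4)) = ∑ m ∈ B, Real.exp (t * (D / 4)) := by
          rw [Finset.sum_const, nsmul_eq_mul]
      _ ≤ ∑ m ∈ B, Real.exp (t * F m) := by
          refine Finset.sum_le_sum fun m hm => ?_
          gcongr
          obtain ⟨a, ha, hae⟩ := A.exists_mem_eq_inf' hne fun a => permDist a m
          simp only [hFdef, hae]
          have := hD a ha m hm
          gcongr
      _ ≤ _ := Finset.sum_le_sum_of_subset_of_nonneg hB fun _ _ _ => (Real.exp_pos _).le
  have h3 : (A.card : ℝ) * (B.card * Real.exp (t * (D / 4))) ≤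
      (pairings H).card ^ 2 * Real.exp (4 * t ^ 2 * N) := by
    refine (mul_le_mul h1 h2 (by positivity) (by positivity)).trans (le_of_eq ?_)
    rw [mul_mul_mul_comm, ← Real.exp_add]
    ring_nf
  have h4 : -(D ^ 2 / (256 * N)) = 4 * t ^ 2 * N - t * (D / 4) := by
    rw [ht]
    field_simp
    ring
  rw [h4, Real.exp_sub, ← mul_div_assoc, le_div_iff₀ (Real.exp_pos _), mul_assoc]
  exact h3

end Pairings

/-! ### Switchings: simple matchings are not too rare -/

section SimplePairings

open Equiv Equiv.Perm

variable {n d : ℕ}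

/-- The ordered pairs of distinct vertices joined by a pairing of the half-edges. -/
def arcs (m : Perm (Fin n × Fin d)) : Finset (Fin n × Fin n) :=
  (Finset.univ.image fun x => (x.1, (m x).1)).filter fun p => p.1 ≠ p.2

theorem mem_arcs {m : Perm (Fin n × Fin d)} {p : Fin n × Fin n} :
    p ∈ arcs m ↔ p.1 ≠ p.2 ∧ ∃ x, x.1 = p.1 ∧ (m x).1 = p.2 := by
  simp only [arcs, Finset.mem_filter, Finset.mem_image, Finset.mem_univ, true_and, Prod.ext_iff]
  tauto

theorem card_arcs_le (m : Perm (Fin n × Fin d)) : (arcs m).card ≤ n * d := by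
  refine (Finset.card_filter_le _ _).trans (Finset.card_image_le.trans ?_)
  simp

/-- A vertex and the vertices joined to it by a pairing of the half-edges. -/
def closedNbh (m : Perm (Fin n × Fin d)) (u : Fin n) : Finset (Fin n) :=
  insert u (Finset.univ.image fun i => (m (u, i)).1)

theorem mem_closedNbh {m : Perm (Fin n × Fin d)} {u v : Fin n} :
    v ∈ closedNbh m u ↔ v = u ∨ ∃ x, x.1 = u ∧ (m x).1 = v := by
  simp [closedNbh]

theorem card_closedNbh_le (m : Perm (Fin n × Fin d)) (u : Fin n) :
    (closedNbh m u).card ≤ d + 1 := by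
  refine (Finset.card_insert_le _ _).trans ?_
  gcongr
  exact Finset.card_image_le.trans (by simp)

theorem card_fst_mem (S : Finset (Fin n)) :
    (Finset.univ.filter fun y : Fin n × Fin d => y.1 ∈ S).card = S.card * d := by
  have : (Finset.univ.filter fun y : Fin n × Fin d => y.1 ∈ S) = S ×ˢ Finset.univ := by
    ext y
    simp
  rw [this, Finset.card_product]
  simp

/-- The half-edges in loops and in multiple edges. -/
def badHalfEdges (m : Perm (Fin n × Fin d)) : Finset (Fin n × Fin d) :=
  Finset.univ.filter fun x => (m x).1 = x.1 ∨ ∃ z, z ≠ x ∧ z.1 = x.1 ∧ (m z).1 = (m x).1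

/-- The half-edges outside loops and multiple edges inject into the arcs. -/
theorem le_card_badHalfEdges (m : Perm (Fin n × Fin d)) :
    n * d - (arcs m).card ≤ (badHalfEdges m).card := by
  have h : (Finset.univ \ badHalfEdges m).card ≤ (arcs m).card := by
    refine Finset.card_le_card_of_injOn (fun x => (x.1, (m x).1)) ?_ ?_
    · intro x hx
      simp only [badHalfEdges, Finset.coe_sdiff, Set.mem_sdiff, Finset.mem_coe, Finset.mem_filter,
        Finset.mem_univ, true_and, not_or] at hx
      rw [Finset.mem_coe, mem_arcs]
      exact ⟨fun h => hx.1 h.symm, x, rfl, rfl⟩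
    · intro x hx z hz h
      simp only [badHalfEdges, Finset.coe_sdiff, Set.mem_sdiff, Finset.mem_coe, Finset.mem_filter,
        Finset.mem_univ, true_and, not_or] at hx
      by_contra hne
      simp only [Prod.mk.injEq] at h
      exact hx.2 ⟨z, fun h => hne h.symm, h.1.symm, h.2.symm⟩
  have h2 := Finset.card_sdiff_add_card_eq_card (Finset.subset_univ (badHalfEdges m))
  rw [Finset.card_univ, Fintype.card_prod, Fintype.card_fin, Fintype.card_fin] at h2
  omega

/-- The half-edges `y` such that neither `y` nor its partner are near the edge of `x`. -/
def farHalfEdges (m : Perm (Fin n × Fin d)) (x : Fin n × Fin d) : Finset (Fin n × Fin d) :=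
  Finset.univ.filter fun y => y.1 ∉ closedNbh m x.1 ∧ (m y).1 ∉ closedNbh m (m x).1

/-- A closed neighborhood carries at most `(d + 1) * d` half-edges. Each of the two conditions
excludes at most that many, the second after applying the bijection `m`. -/
theorem le_card_farHalfEdges (m : Perm (Fin n × Fin d)) (x : Fin n × Fin d) :
    n * d - 2 * ((d + 1) * d) ≤ (farHalfEdges m x).card := by
  have h1 := card_fst_mem (d := d) (closedNbh m x.1)
  have h2 : (Finset.univ.filter fun y => (m y).1 ∈ closedNbh m (m x).1).card =
      (closedNbh m (m x).1).card * d := by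
    rw [← card_fst_mem (d := d) (closedNbh m (m x).1)]
    exact Finset.card_bij (fun y _ => m y) (by simp) (fun _ _ _ _ h => m.injective h)
      fun z hz => ⟨m⁻¹ z, by simpa using hz, by simp⟩
  have h3 := Nat.mul_le_mul_right d (card_closedNbh_le m x.1)
  have h4 := Nat.mul_le_mul_right d (card_closedNbh_le m (m x).1)
  have h5 : (Finset.univ : Finset (Fin n × Fin d)) ⊆ farHalfEdges m x ∪
      ((Finset.univ.filter fun y => y.1 ∈ closedNbh m x.1) ∪
        Finset.univ.filter fun y => (m y).1 ∈ closedNbh m (m x).1) := by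
    intro y _
    simp only [farHalfEdges, Finset.mem_union, Finset.mem_filter, Finset.mem_univ, true_and]
    tauto
  have h6 := Finset.card_le_card h5
  have h7 := Finset.card_union_le (farHalfEdges m x)
    ((Finset.univ.filter fun y => y.1 ∈ closedNbh m x.1) ∪
        Finset.univ.filter fun y => (m y).1 ∈ closedNbh m (m x).1)
  have h8 := Finset.card_union_le (Finset.univ.filter fun y => y.1 ∈ closedNbh m x.1)
        (Finset.univ.filter fun y => (m y).1 ∈ closedNbh m (m x).1)
  rw [Finset.card_univ, Fintype.card_prod, Fintype.card_fin, Fintype.card_fin] at h6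
  omega

/-- The pairing obtained by joining `x` to `y`, and the partner of `x` to the partner of `y`. -/
def switching (m : Perm (Fin n × Fin d)) (x y : Fin n × Fin d) : Perm (Fin n × Fin d) :=
  swap (m x) y * m * swap (m x) y

theorem switching_mem {m : Perm (Fin n × Fin d)} (hm : m ∈ pairings (Fin n × Fin d))
    (x y : Fin n × Fin d) : switching m x y ∈ pairings (Fin n × Fin d) := by
  simpa [switching] using conj_mem_pairings hm (swap (m x) y)

section Switching

variable {m : Perm (Fin n × Fin d)} (hm : m ∈ pairings (Fin n × Fin d)) {x y : Fin n × Fin d}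
  (hx : x ∈ badHalfEdges m) (hy : y ∈ farHalfEdges m x)

include hm hy in
theorem far_ne : y.1 ≠ x.1 ∧ y.1 ≠ (m x).1 ∧ (m y).1 ≠ x.1 ∧ (m y).1 ≠ (m x).1 := by
  rw [mem_pairings] at hm
  simp only [farHalfEdges, Finset.mem_filter, Finset.mem_univ, true_and, mem_closedNbh,
    not_or, not_exists, not_and] at hy
  obtain ⟨⟨h1, h2⟩, h3, h4⟩ := hy
  exact ⟨h1, fun h => h2 x rfl h.symm, fun h => h4 (m x) rfl (by rw [hm.1, h]), h3⟩

include hm hy in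
theorem switching_apply_left : switching m x y x = y := by
  obtain ⟨h1, h2, h3, h4⟩ := far_ne hm hy
  rw [mem_pairings] at hm
  simp only [switching, coe_mul, Function.comp_apply]
  rw [swap_apply_of_ne_of_ne (hm.2 x).symm (fun h => h1 (by rw [← h])), swap_apply_left]

include hm hy in
theorem switching_apply_partner : switching m x y (m x) = m y := by
  obtain ⟨h1, h2, h3, h4⟩ := far_ne hm hy
  rw [mem_pairings] at hm
  simp only [switching, coe_mul, Function.comp_apply]
  rw [swap_apply_left, swap_apply_of_ne_of_ne (fun h => h4 (by rw [h])) (hm.2 y)]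

include hm in
theorem switching_apply_of_ne {z : Fin n × Fin d} (h1 : z ≠ x) (h2 : z ≠ y) (h3 : z ≠ m x)
    (h4 : z ≠ m y) : switching m x y z = m z := by
  rw [mem_pairings] at hm
  simp only [switching, coe_mul, Function.comp_apply]
  rw [swap_apply_of_ne_of_ne h3 h2, swap_apply_of_ne_of_ne (fun h => h1 (m.injective h))
    (fun h => h4 (by rw [← h, hm.1]))]

-- If a bad half-edge is not in a loop, its edge has a parallel copy. The switching leaves this copy
-- untouched, because the edge of `y` is far away.
include hm hx hy in
theorem exists_parallel (hxx : (m x).1 ≠ x.1) : ∃ z, z.1 = x.1 ∧ (m z).1 = (m x).1 ∧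
    switching m x y z = m z ∧ switching m x y (m z) = z := by
  obtain ⟨h1, h2, h3, h4⟩ := far_ne hm hy
  simp only [badHalfEdges, Finset.mem_filter, Finset.mem_univ, true_and] at hx
  obtain ⟨z, hz1, hz2, hz3⟩ := hx.resolve_left hxx
  have hz : switching m x y z = m z := by
    refine switching_apply_of_ne hm hz1 ?_ ?_ ?_
    · rintro rfl; exact h1 hz2
    · rintro rfl; exact hxx hz2
    · rintro rfl; exact h3 hz2
  refine ⟨z, hz2, hz3, hz, ?_⟩
  have := (mem_pairings.1 (switching_mem hm x y)).1 z
  rwa [hz] at this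

-- Removing the edge of `x` loses no arc, as it is a loop or has a parallel copy. Only the arcs of
-- the edge of `y` can disappear.
include hm hx hy in
theorem arcs_sdiff_subset_switching :
    arcs m \ {(y.1, (m y).1), ((m y).1, y.1)} ⊆ arcs (switching m x y) := by
  have hinv := (mem_pairings.1 hm).1
  intro p hp
  rw [Finset.mem_sdiff, mem_arcs] at hp
  obtain ⟨⟨hne, z, hz1, hz2⟩, hp⟩ := hp
  obtain ⟨a, b⟩ := p
  simp only at hz1 hz2 hne
  subst hz1 hz2
  rw [mem_arcs]
  refine ⟨hne, ?_⟩
  by_cases hzx : z = x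
  · subst hzx
    obtain ⟨z', h1, h2, h3, h4⟩ := exists_parallel hm hx hy hne.symm
    exact ⟨z', h1, by rw [h3, h2]⟩
  by_cases hzb : z = m x
  · subst hzb
    rw [hinv] at hne ⊢
    obtain ⟨z', h1, h2, h3, h4⟩ := exists_parallel hm hx hy hne
    exact ⟨m z', h2, by rw [h4, h1]⟩
  refine ⟨z, rfl, ?_⟩
  rw [switching_apply_of_ne hm hzx ?_ hzb ?_]
  · rintro rfl
    simp at hp
  · rintro rfl
    simp [hinv] at hp

-- If `y` is in a loop, no arc is lost and `(x.1, y.1)` is new. Otherwise at most two arcs are lost,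
-- and at least three are gained: the two orientations between `x` and `y`, and one between their
-- former partners. Three suffice, which avoids having to distinguish `x.1` from `(m x).1`.
include hm hx hy in
theorem card_arcs_lt_switching : (arcs m).card < (arcs (switching m x y)).card := by
  obtain ⟨h1, h2, h3, h4⟩ := far_ne hm hy
  have hinv := (mem_pairings.1 hm).1
  have hsub := arcs_sdiff_subset_switching hm hx hy
  have hl := switching_apply_left hm hy
  have hp := switching_apply_partner hm hy
  have hinv' := (mem_pairings.1 (switching_mem hm x y)).1
  have hl' : switching m x y y = x := by
    have := hinv' x
    rwa [hl] at this
  have hfar := hy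
  simp only [farHalfEdges, Finset.mem_filter, Finset.mem_univ, true_and, mem_closedNbh,
    not_or, not_exists, not_and] at hfar
  obtain ⟨⟨-, hf1⟩, -, hf2⟩ := hfar
  have n1 : (x.1, y.1) ∈ arcs (switching m x y) \ arcs m := by
    rw [Finset.mem_sdiff, mem_arcs, mem_arcs]
    exact ⟨⟨h1.symm, x, rfl, by rw [hl]⟩, fun ⟨_, z, hz1, hz2⟩ => hf1 z hz1 hz2⟩
  by_cases hyy : y.1 = (m y).1
  · refine Finset.card_lt_card (Finset.ssubset_iff_exists_cons_subset.2 ?_)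
    refine ⟨(x.1, y.1), (Finset.mem_sdiff.1 n1).2, ?_⟩
    rw [Finset.cons_eq_insert, Finset.insert_subset_iff]
    refine ⟨(Finset.mem_sdiff.1 n1).1, fun p hpm => hsub ?_⟩
    rw [Finset.mem_sdiff]
    refine ⟨hpm, ?_⟩
    have := (mem_arcs.1 hpm).1
    simp only [Finset.mem_insert, Finset.mem_singleton]
    rintro (rfl | rfl)
    · exact this hyy
    · exact this hyy.symm
  · have n2 : (y.1, x.1) ∈ arcs (switching m x y) \ arcs m := by
      rw [Finset.mem_sdiff, mem_arcs, mem_arcs]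
      exact ⟨⟨h1, y, rfl, by rw [hl']⟩, fun ⟨_, z, hz1, hz2⟩ =>
        hf1 (m z) hz2 (by rw [hinv]; exact hz1)⟩
    have n3 : ((m x).1, (m y).1) ∈ arcs (switching m x y) \ arcs m := by
      rw [Finset.mem_sdiff, mem_arcs, mem_arcs]
      exact ⟨⟨h4.symm, m x, rfl, by rw [hp]⟩, fun ⟨_, z, hz1, hz2⟩ => hf2 z hz1 hz2⟩
    have hcard : ({(x.1, y.1), (y.1, x.1), ((m x).1, (m y).1)} : Finset (Fin n × Fin n)).card = 3 := by
      rw [Finset.card_eq_three]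
      refine ⟨_, _, _, ?_, ?_, ?_, rfl⟩ <;> simp only [ne_eq, Prod.mk.injEq, not_and]
      · exact fun h => absurd h.symm h1
      · exact fun _ => hyy
      · exact fun h => absurd h h2
    have h5 : {(x.1, y.1), (y.1, x.1), ((m x).1, (m y).1)} ⊆ arcs (switching m x y) \ arcs m := by
      simp only [Finset.insert_subset_iff, Finset.singleton_subset_iff]
      exact ⟨n1, n2, n3⟩
    have h6 := Finset.card_le_card h5
    have h7 := Finset.card_le_card hsub
    have h8 := Finset.le_card_sdiff {(y.1, (m y).1), ((m y).1, y.1)} (arcs m)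
    have h9 : ({(y.1, (m y).1), ((m y).1, y.1)} : Finset (Fin n × Fin n)).card ≤ 2 :=
      Finset.card_le_two
    have h10 : Disjoint (arcs m \ {(y.1, (m y).1), ((m y).1, y.1)})
        (arcs (switching m x y) \ arcs m) :=
      Finset.disjoint_sdiff.mono_left Finset.sdiff_subset
    have h11 := Finset.card_le_card (Finset.union_subset hsub
      (Finset.sdiff_subset (s := arcs (switching m x y)) (t := arcs m)))
    rw [Finset.card_union_of_disjoint h10] at h11
    omega

-- Used to count the inverse switchings: given the new matching and `x`, the former partner of `x`
-- is one of at most `(d + 1) * d` half-edges.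
include hm hx hy in
theorem partner_mem_closedNbh_switching : (m x).1 ∈ closedNbh (switching m x y) x.1 := by
  rw [mem_closedNbh]
  by_cases h : (m x).1 = x.1
  · exact Or.inl h
  · obtain ⟨z, h1, h2, h3, -⟩ := exists_parallel hm hx hy h
    exact Or.inr ⟨z, h1, by rw [h3, h2]⟩

end Switching

variable (n d) in
/-- The pairings whose graph has `k` arcs less than half-edges. -/
def defectPairings (k : ℕ) : Finset (Perm (Fin n × Fin d)) :=
  (pairings (Fin n × Fin d)).filter fun m => n * d - (arcs m).card = k

variable (n d) in
/-- The pairings whose graph has more than `n * d - k` arcs. -/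
def defectPairingsLT (k : ℕ) : Finset (Perm (Fin n × Fin d)) :=
  (pairings (Fin n × Fin d)).filter fun m => n * d - (arcs m).card < k

/-- Double counting of switchings: a matching of defect `k` has at least `k` bad half-edges `x`,
each with many far `y`. The resulting matching has smaller defect and, together with `x` and the old
partner of `x`, determines the switching. -/
theorem mul_card_defectPairings_le (k : ℕ) :
    k * (n * d - 2 * ((d + 1) * d)) * (defectPairings n d k).card ≤
      n * d * ((d + 1) * d) * (defectPairingsLT n d k).card := by
  let T := (defectPairings n d k).sigma fun m => (badHalfEdges m).sigma fun x => farHalfEdges m x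
  let U := (defectPairingsLT n d k).sigma fun m =>
    (Finset.univ : Finset (Fin n × Fin d)).sigma fun a =>
      Finset.univ.filter fun b : Fin n × Fin d => b.1 ∈ closedNbh m a.1
  have hT : k * (n * d - 2 * ((d + 1) * d)) * (defectPairings n d k).card ≤ T.card := by
    simp only [T]
    rw [Finset.card_sigma, mul_comm, ← smul_eq_mul]
    refine Finset.card_nsmul_le_sum _ _ _ fun m hm => ?_
    rw [Finset.card_sigma]
    have hk : k ≤ (badHalfEdges m).card := by
      rw [← (Finset.mem_filter.1 hm).2]
      exact le_card_badHalfEdges m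
    refine (Nat.mul_le_mul_right _ hk).trans ?_
    rw [← smul_eq_mul]
    exact Finset.card_nsmul_le_sum _ _ _ fun x _ => le_card_farHalfEdges m x
  have hU : U.card ≤ n * d * ((d + 1) * d) * (defectPairingsLT n d k).card := by
    simp only [U]
    rw [Finset.card_sigma, mul_comm, ← smul_eq_mul]
    refine Finset.sum_le_card_nsmul _ _ _ fun m _ => ?_
    rw [Finset.card_sigma]
    refine (Finset.sum_le_card_nsmul _ _ ((d + 1) * d) fun a _ => ?_).trans (by simp)
    rw [card_fst_mem]
    exact Nat.mul_le_mul_right _ (card_closedNbh_le _ _)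
  refine hT.trans (le_trans ?_ hU)
  refine Finset.card_le_card_of_injOn
    (fun t => ⟨switching t.1 t.2.1 t.2.2, t.2.1, t.1 t.2.1⟩) ?_ ?_
  · rintro ⟨m, x, y⟩ ht
    simp only [T, Finset.coe_sigma, Set.mem_sigma_iff, Finset.mem_coe] at ht
    obtain ⟨hm, hx, hy⟩ := ht
    obtain ⟨hm, hk⟩ := Finset.mem_filter.1 hm
    simp only [U, Finset.coe_sigma, Set.mem_sigma_iff, Finset.mem_coe, Finset.mem_filter,
      Finset.mem_univ, true_and, defectPairingsLT]
    refine ⟨⟨switching_mem hm x y, ?_⟩, partner_mem_closedNbh_switching hm hx hy⟩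
    have h1 := card_arcs_lt_switching hm hx hy
    have h2 := card_arcs_le (switching m x y)
    omega
  -- The half-edge `y` is the new partner of `x`; undoing the conjugation by `swap (m x) y` then
  -- recovers `m`.
  · rintro ⟨m, x, y⟩ ht ⟨m', x', y'⟩ ht' h
    simp only [T, Finset.coe_sigma, Set.mem_sigma_iff, Finset.mem_coe] at ht ht'
    obtain ⟨hm, hx, hy⟩ := ht
    obtain ⟨hm', hx', hy'⟩ := ht'
    simp only [Sigma.mk.injEq, heq_eq_eq] at h
    obtain ⟨h1, h2⟩ := h
    obtain ⟨rfl, h3⟩ := h2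
    have e1 := switching_apply_left (Finset.mem_filter.1 hm).1 hy
    have e2 := switching_apply_left (Finset.mem_filter.1 hm').1 hy'
    have hyy : y = y' := by rw [← e1, h1, e2]
    subst hyy
    simp only [switching, ← h3] at h1
    have : m = m' := by simpa using h1
    subst this
    rfl

variable (n d) in
/-- The pairings whose graph is simple. -/
def simplePairings : Finset (Perm (Fin n × Fin d)) :=
  (pairings (Fin n × Fin d)).filter fun m => (arcs m).card = n * d

/-- The proportion of simple pairings is at least polynomially small. -/
theorem card_pairings_le (hn : 4 * ((d + 1) * d) ≤ n * d) :
    ((pairings (Fin n × Fin d)).card : ℝ) ≤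
      (n * d + 1 : ℝ) ^ (2 * ((d + 1) * d)) * (simplePairings n d).card := by
  set C := 2 * ((d + 1) * d) with hC
  -- The assumption on `n` says that `2 * C ≤ n * d`, so `n * d - C` is at least half of `n * d` and
  -- the factors `n * d` cancel.
  have hstep : ∀ k : ℕ, (k : ℝ) * (defectPairings n d k).card ≤ C * (defectPairingsLT n d k).card := by
    intro k
    rcases (n * d).eq_zero_or_pos with h0 | hpos
    · have h1 : k * (defectPairings n d k).card = 0 := by
        rw [Nat.mul_eq_zero, Finset.card_eq_zero, Finset.eq_empty_iff_forall_notMem]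
        rcases k.eq_zero_or_pos with hk | hk
        · exact Or.inl hk
        · right
          intro m hm
          have := (Finset.mem_filter.1 hm).2
          omega
      have h2 : (k : ℝ) * (defectPairings n d k).card = 0 := by exact_mod_cast h1
      rw [h2]
      positivity
    · have h1 := mul_card_defectPairings_le (n := n) (d := d) k
      have h2 : n * d ≤ 2 * (n * d - C) := by omega
      have h3 : n * d * (k * (defectPairings n d k).card) ≤
          n * d * (C * (defectPairingsLT n d k).card) := by
        calc n * d * (k * (defectPairings n d k).card)
            ≤ 2 * (n * d - C) * (k * (defectPairings n d k).card) := Nat.mul_le_mul_right _ h2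
          _ = 2 * (k * (n * d - C) * (defectPairings n d k).card) := by ring
          _ ≤ 2 * (n * d * ((d + 1) * d) * (defectPairingsLT n d k).card) :=
            Nat.mul_le_mul_left _ h1
          _ = _ := by rw [hC]; ring
      exact_mod_cast Nat.le_of_mul_le_mul_left h3 hpos
  have hsum : ∀ k, (defectPairingsLT n d (k + 1)).card =
      (defectPairingsLT n d k).card + (defectPairings n d k).card := by
    intro k
    rw [← Finset.card_union_of_disjoint]
    · congr 1
      ext m
      simp only [defectPairingsLT, defectPairings, Finset.mem_union, Finset.mem_filter,
        ← and_or_left, Nat.lt_succ_iff_lt_or_eq]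
    · rw [defectPairingsLT, defectPairings, Finset.disjoint_filter]
      omega
  -- Adding the class of defect `k + 1` multiplies the count by at most `1 + C / (k + 1)`, which
  -- Bernoulli's inequality bounds by `((k + 2) / (k + 1)) ^ C`; these factors telescope.
  have hind : ∀ k : ℕ, ((defectPairingsLT n d (k + 1)).card : ℝ) ≤
      (k + 1 : ℝ) ^ C * (defectPairingsLT n d 1).card := by
    intro k
    induction k with
    | zero => simp
    | succ k ih =>
      have h1 := hstep (k + 1)
      rw [hsum]
      push_cast at h1 ⊢
      have hk : (0 : ℝ) < k + 1 := by positivity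
      have h2 : ((defectPairings n d (k + 1)).card : ℝ) ≤
          C * (1 / (k + 1 : ℝ)) * (defectPairingsLT n d (k + 1)).card := by
        rw [mul_one_div, div_mul_eq_mul_div, le_div_iff₀ hk, mul_comm]
        exact h1
      have h3 : 1 + C * (1 / (k + 1 : ℝ)) ≤ (1 + 1 / (k + 1 : ℝ)) ^ C :=
        one_add_mul_le_pow (by have : 0 < 1 / (k + 1 : ℝ) := by positivity
                               linarith) C
      calc ((defectPairingsLT n d (k + 1)).card : ℝ) + (defectPairings n d (k + 1)).card
          ≤ (1 + C * (1 / (k + 1 : ℝ))) * (defectPairingsLT n d (k + 1)).card := by linarith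
        _ ≤ (1 + 1 / (k + 1 : ℝ)) ^ C * ((k + 1 : ℝ) ^ C * (defectPairingsLT n d 1).card) := by
          gcongr
        _ = (k + 1 + 1 : ℝ) ^ C * (defectPairingsLT n d 1).card := by
          rw [← mul_assoc, ← mul_pow]
          congr 2
          field_simp
  have h := hind (n * d)
  have h1 : defectPairingsLT n d (n * d + 1) = pairings (Fin n × Fin d) := by
    rw [defectPairingsLT, Finset.filter_true_of_mem]
    intro m _
    omega
  have h2 : defectPairingsLT n d 1 = simplePairings n d := by
    refine Finset.filter_congr fun m _ => ?_
    have := card_arcs_le m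
    omega
  rw [h1, h2] at h
  exact_mod_cast h

end SimplePairings

/-! ### From matchings to uniform regular graphs -/

section PairGraph

open Equiv Equiv.Perm

variable {n d : ℕ}

/-- The simple graph underlying the multigraph of a pairing of the half-edges. -/
def pairGraph (m : Perm (Fin n × Fin d)) : SimpleGraph (Fin n) :=
  SimpleGraph.fromRel fun u v => (u, v) ∈ arcs m

theorem pairGraph_adj {m : Perm (Fin n × Fin d)} (hm : m ∈ pairings (Fin n × Fin d))
    {u v : Fin n} : (pairGraph m).Adj u v ↔ u ≠ v ∧ ∃ i, (m (u, i)).1 = v := by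
  have h : ∀ u v : Fin n, (u, v) ∈ arcs m ↔ u ≠ v ∧ ∃ i, (m (u, i)).1 = v := by
    intro u v
    rw [mem_arcs]
    constructor
    · rintro ⟨h, ⟨a, i⟩, rfl, h2⟩
      exact ⟨h, i, h2⟩
    · rintro ⟨h, i, h2⟩
      exact ⟨h, (u, i), rfl, h2⟩
  have hs : ∀ u v : Fin n, (u, v) ∈ arcs m → (v, u) ∈ arcs m := by
    intro u v huv
    rw [mem_arcs] at huv ⊢
    obtain ⟨h1, x, h2, h3⟩ := huv
    exact ⟨h1.symm, m x, h3, by rw [(mem_pairings.1 hm).1, h2]⟩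
  rw [← h, pairGraph, SimpleGraph.fromRel_adj]
  constructor
  · rintro ⟨-, h1 | h1⟩
    · exact h1
    · exact hs _ _ h1
  · exact fun h1 => ⟨(mem_arcs.1 h1).1, Or.inl h1⟩

/-- With `n * d` arcs, no two half-edges give the same arc and none is in a loop, so the `d`
half-edges at a vertex lead to `d` distinct neighbors. -/
theorem pairGraph_mem_regularGraphs {m : Perm (Fin n × Fin d)} (hm : m ∈ simplePairings n d) :
    pairGraph m ∈ regularGraphs d n := by
  obtain ⟨hm, hc⟩ := Finset.mem_filter.1 hm
  set S : Finset (Fin n × Fin n) := Finset.univ.image fun x => (x.1, (m x).1) with hS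
  have h1 : S.card ≤ n * d := Finset.card_image_le.trans (by simp)
  have h2 : arcs m = S := Finset.eq_of_subset_of_card_le (Finset.filter_subset _ _) (by omega)
  have hinj : Function.Injective fun x : Fin n × Fin d => (x.1, (m x).1) := by
    rw [← Set.injOn_univ, ← Finset.coe_univ, ← Finset.card_image_iff, ← hS, ← h2, hc]
    simp
  intro u
  have hN : (pairGraph m).neighborSet u = Set.range fun i => (m (u, i)).1 := by
    ext v
    rw [SimpleGraph.mem_neighborSet, pairGraph_adj hm, Set.mem_range, and_iff_right_iff_imp]
    rintro ⟨i, rfl⟩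
    have : (u, (m (u, i)).1) ∈ arcs m := by
      rw [h2]
      exact Finset.mem_image_of_mem (fun x => (x.1, (m x).1)) (Finset.mem_univ (u, i))
    exact (mem_arcs.1 this).1
  rw [hN, ← Set.image_univ, Set.ncard_image_of_injective]
  · simp
  · intro i j hij
    have := hinj (a₁ := (u, i)) (a₂ := (u, j)) (by simpa using hij)
    simpa using this

/-- The ways to distribute the neighbors of each vertex among its half-edges. -/
def neighborLabelings (d : ℕ) (G : SimpleGraph (Fin n)) : Set (Fin n → Fin d → Fin n) :=
  {φ | ∀ u, Function.Injective (φ u) ∧ Set.range (φ u) = G.neighborSet u}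

theorem card_neighborLabelings {G : SimpleGraph (Fin n)} (hG : G ∈ regularGraphs d n) :
    Nat.card (neighborLabelings d G) = Nat.factorial d ^ n := by
  classical
  have h1 : ∀ u, Nat.card {g : Fin d → Fin n // Function.Injective g ∧
      Set.range g = G.neighborSet u} = Nat.factorial d := by
    intro u
    have hc : Fintype.card (G.neighborSet u) = d := by
      rw [← Nat.card_eq_fintype_card, Nat.card_coe_set_eq]
      exact hG u
    have hd : Nat.card (Fin d ≃ G.neighborSet u) = Nat.factorial d := by
      rw [Nat.card_eq_fintype_card,
        Fintype.card_equiv (Fintype.equivFinOfCardEq hc).symm, Fintype.card_fin]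
    rw [← hd]
    symm
    refine Nat.card_congr (Equiv.ofBijective (fun e => ⟨fun i => (e i).1,
      Subtype.val_injective.comp e.injective, ?_⟩) ⟨?_, ?_⟩)
    · change Set.range (Subtype.val ∘ e) = _
      rw [e.surjective.range_comp, Subtype.range_coe]
    · intro e e' h
      ext i : 2
      exact congrFun (congrArg Subtype.val h) i
    · rintro ⟨g, hg, hr⟩
      refine ⟨Equiv.ofBijective (fun i => ⟨g i, hr ▸ Set.mem_range_self i⟩) ⟨?_, ?_⟩, rfl⟩
      · intro i j h
        exact hg (congrArg Subtype.val h)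
      · rintro ⟨v, hv⟩
        rw [← hr] at hv
        obtain ⟨i, rfl⟩ := hv
        exact ⟨i, rfl⟩
  have e : neighborLabelings d G ≃
      ∀ u, {g : Fin d → Fin n // Function.Injective g ∧ Set.range g = G.neighborSet u} :=
    Equiv.subtypePiEquivPi (p := fun u (g : Fin d → Fin n) =>
      Function.Injective g ∧ Set.range g = G.neighborSet u)
  rw [Nat.card_congr e, Nat.card_pi, Finset.prod_congr rfl fun u _ => h1 u, Finset.prod_const]
  simp

/-- The `d` half-edges at a vertex must cover its `d` neighbors, hence do so bijectively; simplicity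
of the matching is automatic. -/
theorem labeling_of_pairGraph_eq {G : SimpleGraph (Fin n)} (hG : G ∈ regularGraphs d n)
    {m : Perm (Fin n × Fin d)} (hm : m ∈ pairings (Fin n × Fin d)) (h : pairGraph m = G) :
    (fun u i => (m (u, i)).1) ∈ neighborLabelings d G := by
  intro u
  have hsub : G.neighborSet u ⊆ Set.range fun i => (m (u, i)).1 := by
    intro v hv
    rw [SimpleGraph.mem_neighborSet, ← h, pairGraph_adj hm] at hv
    exact hv.2
  have hle : (Set.range fun i => (m (u, i)).1).ncard ≤ d := by
    rw [← Set.image_univ]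
    exact (Set.ncard_image_le).trans (by simp)
  have heq : G.neighborSet u = Set.range fun i => (m (u, i)).1 :=
    Set.eq_of_subset_of_ncard_le hsub (by rw [hG u]; exact hle)
  refine ⟨?_, heq.symm⟩
  rw [← Set.injOn_univ]
  refine Set.injOn_of_ncard_image_eq ?_
  rw [Set.image_univ, ← heq, hG u]
  simp

/-- The half-edge of `u` pointing to `v` is matched with the half-edge of `v` pointing to `u`.
Injectivity of the labels makes this an involution. -/
theorem exists_pairing_of_labeling {G : SimpleGraph (Fin n)} {φ : Fin n → Fin d → Fin n}
    (hφ : φ ∈ neighborLabelings d G) : ∃ m ∈ pairings (Fin n × Fin d),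
      pairGraph m = G ∧ (fun u i => (m (u, i)).1) = φ := by
  have hadj : ∀ u i, G.Adj u (φ u i) := by
    intro u i
    rw [← SimpleGraph.mem_neighborSet, ← (hφ u).2]
    exact Set.mem_range_self i
  have hex : ∀ x : Fin n × Fin d, ∃ j, φ (φ x.1 x.2) j = x.1 := by
    intro x
    rw [← Set.mem_range, (hφ _).2]
    exact (hadj _ _).symm
  choose j hj using hex
  let f : Fin n × Fin d → Fin n × Fin d := fun x => (φ x.1 x.2, j x)
  have hf : Function.Involutive f := by
    intro x
    have h1 : (f (f x)).1 = x.1 := hj x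
    refine Prod.ext h1 ?_
    have h2 : φ (f (f x)).1 (f (f x)).2 = (f x).1 := hj (f x)
    rw [h1] at h2
    exact (hφ x.1).1 h2
  have hm : hf.toPerm ∈ pairings (Fin n × Fin d) := by
    rw [mem_pairings]
    refine ⟨hf, fun x h => (hadj x.1 x.2).ne ?_⟩
    exact (congrArg Prod.fst h).symm
  refine ⟨hf.toPerm, hm, ?_, rfl⟩
  ext u v
  rw [pairGraph_adj hm, ← SimpleGraph.mem_neighborSet G, ← (hφ u).2]
  simp only [Function.Involutive.coe_toPerm, f, Set.mem_range, and_iff_right_iff_imp]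
  rintro ⟨i, rfl⟩
  exact (hadj u i).ne

open Classical in
/-- Every regular graph comes from the same number of pairings of the half-edges. -/
theorem card_pairGraph_eq {G : SimpleGraph (Fin n)} (hG : G ∈ regularGraphs d n) :
    ((pairings (Fin n × Fin d)).filter fun m => pairGraph m = G).card = Nat.factorial d ^ n := by
  set F := (pairings (Fin n × Fin d)).filter fun m => pairGraph m = G
  have hinj : Set.InjOn (fun (m : Perm (Fin n × Fin d)) u i => (m (u, i)).1) F := by
    intro m hm m' hm' h
    obtain ⟨hm, hmG⟩ := Finset.mem_filter.1 hm
    obtain ⟨hm', -⟩ := Finset.mem_filter.1 hm'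
    have h1 : ∀ x, (m x).1 = (m' x).1 := fun x => congrFun (congrFun h x.1) x.2
    ext1 x
    refine Prod.ext (h1 x) (((labeling_of_pairGraph_eq hG hm hmG) (m x).1).1 ?_)
    have h2 : (m (m x)).1 = x.1 := by rw [(mem_pairings.1 hm).1]
    have h3 : (m (m' x)).1 = x.1 := by rw [h1, (mem_pairings.1 hm').1]
    change (m (m x)).1 = (m ((m x).1, (m' x).2)).1
    rw [h1 x, h2]
    exact h3.symm
  have himg : (fun (m : Perm (Fin n × Fin d)) u i => (m (u, i)).1) '' F =
      neighborLabelings d G := by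
    ext φ
    constructor
    · rintro ⟨m, hm, rfl⟩
      obtain ⟨hm, hmG⟩ := Finset.mem_filter.1 hm
      exact labeling_of_pairGraph_eq hG hm hmG
    · intro hφ
      obtain ⟨m, hm, hmG, rfl⟩ := exists_pairing_of_labeling hφ
      exact ⟨m, Finset.mem_filter.2 ⟨hm, hmG⟩, rfl⟩
  rw [← card_neighborLabelings hG, Nat.card_coe_set_eq, ← himg, hinj.ncard_image,
    Set.ncard_coe_finset]

open Classical in
/-- The pairings whose graph is in a given set. -/
noncomputable def pairingsOf (d : ℕ) (A : Set (SimpleGraph (Fin n))) :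
    Finset (Perm (Fin n × Fin d)) :=
  (pairings (Fin n × Fin d)).filter fun m => pairGraph m ∈ A

theorem mem_pairingsOf {A : Set (SimpleGraph (Fin n))} {m : Perm (Fin n × Fin d)} :
    m ∈ pairingsOf d A ↔ m ∈ pairings (Fin n × Fin d) ∧ pairGraph m ∈ A := by
  simp [pairingsOf]

theorem pairingsOf_subset (A : Set (SimpleGraph (Fin n))) :
    pairingsOf d A ⊆ pairings (Fin n × Fin d) := fun _ hm => (mem_pairingsOf.1 hm).1

theorem card_pairingsOf {A : Set (SimpleGraph (Fin n))} (hA : A ⊆ regularGraphs d n) :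
    (pairingsOf d A).card = A.ncard * Nat.factorial d ^ n := by
  classical
  have hfin : A.Finite := Set.toFinite A
  rw [Set.ncard_eq_toFinset_card A hfin, ← smul_eq_mul, ← Finset.sum_const,
    Finset.card_eq_sum_card_fiberwise (f := pairGraph) (t := hfin.toFinset)]
  · refine Finset.sum_congr rfl fun G hG => ?_
    rw [Set.Finite.mem_toFinset] at hG
    rw [← card_pairGraph_eq (hA hG), pairingsOf, Finset.filter_filter]
    congr 1
    refine Finset.filter_congr fun m _ => ?_
    constructor
    · exact fun h => h.2
    · rintro rfl
      exact ⟨hG, rfl⟩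
  · intro m hm
    simpa using (mem_pairingsOf.1 hm).2

/-- The proportion of a set of regular graphs among the pairings is at least its proportion among
the regular graphs, up to a polynomial factor. -/
theorem ncard_mul_card_pairings_le (hn : 4 * ((d + 1) * d) ≤ n * d)
    {A : Set (SimpleGraph (Fin n))} (hA : A ⊆ regularGraphs d n) :
    (A.ncard : ℝ) * (pairings (Fin n × Fin d)).card ≤
      (n * d + 1 : ℝ) ^ (2 * ((d + 1) * d)) * ((regularGraphs d n).ncard *
        (pairingsOf d A).card) := by
  have h1 : (simplePairings n d).card ≤ (regularGraphs d n).ncard * Nat.factorial d ^ n := by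
    rw [← card_pairingsOf subset_rfl]
    refine Finset.card_le_card fun m hm => ?_
    exact mem_pairingsOf.2 ⟨(Finset.mem_filter.1 hm).1, pairGraph_mem_regularGraphs hm⟩
  have h2 : ((simplePairings n d).card : ℝ) ≤ (regularGraphs d n).ncard * Nat.factorial d ^ n := by
    exact_mod_cast h1
  calc (A.ncard : ℝ) * (pairings (Fin n × Fin d)).card
      ≤ A.ncard * ((n * d + 1 : ℝ) ^ (2 * ((d + 1) * d)) *
        ((regularGraphs d n).ncard * Nat.factorial d ^ n)) := by
        gcongr
        exact (card_pairings_le hn).trans (by gcongr)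
    _ = _ := by
        rw [card_pairingsOf hA]
        push_cast
        ring

/-- The vertices at which two graphs have different neighbors. -/
def diffVerts (G G' : SimpleGraph (Fin n)) : Set (Fin n) :=
  {u | ∃ v, ¬ (G.Adj u v ↔ G'.Adj u v)}

/-- A vertex whose neighbors change carries a half-edge whose partner changes. -/
theorem ncard_diffVerts_le {m m' : Perm (Fin n × Fin d)} (hm : m ∈ pairings (Fin n × Fin d))
    (hm' : m' ∈ pairings (Fin n × Fin d)) :
    (diffVerts (pairGraph m) (pairGraph m')).ncard ≤ permDist m m' := by
  have h : diffVerts (pairGraph m) (pairGraph m') ⊆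
      ((Finset.univ.filter fun x => m x ≠ m' x).image Prod.fst : Finset (Fin n)) := by
    rintro u ⟨v, huv⟩
    rw [pairGraph_adj hm, pairGraph_adj hm'] at huv
    by_contra hc
    simp only [Finset.coe_image, Finset.coe_filter, Finset.mem_univ, true_and, Set.mem_image,
      Set.mem_ofPred_eq, Prod.exists, exists_and_right, exists_eq_right, not_exists,
      not_not] at hc
    simp only [hc, not_true_eq_false] at huv
  refine (Set.ncard_le_ncard h).trans ?_
  rw [Set.ncard_coe_finset]
  exact Finset.card_image_le

/-- If all pairs of graphs were far apart, so would be their matchings, and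
`card_mul_card_le_of_permDist` would contradict `h`. The square of the polynomial factor comes from
transferring both sets. -/
theorem exists_ncard_diffVerts_lt (hn : 4 * ((d + 1) * d) ≤ n * d)
    {A B : Set (SimpleGraph (Fin n))} (hA : A ⊆ regularGraphs d n) (hB : B ⊆ regularGraphs d n)
    {D : ℝ} (hD : 0 ≤ D)
    (h : ((n * d + 1 : ℝ) ^ (2 * ((d + 1) * d)) * (regularGraphs d n).ncard) ^ 2 *
      Real.exp (-(D ^ 2 / (256 * (n * d)))) < A.ncard * B.ncard) :
    ∃ G ∈ A, ∃ G' ∈ B, ((diffVerts G G').ncard : ℝ) < D := by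
  by_contra! hc
  have hne : 0 < (pairings (Fin n × Fin d)).card := by
    have hA0 : A.ncard ≠ 0 := by
      rintro h0
      rw [h0, Nat.cast_zero, zero_mul] at h
      exact absurd h (not_lt.2 (by positivity))
    have h1 := card_pairingsOf hA
    have h2 : 0 < A.ncard * Nat.factorial d ^ n := by positivity
    rw [← h1] at h2
    exact h2.trans_le (Finset.card_le_card (pairingsOf_subset _))
  have h1 := card_mul_card_le_of_permDist (A := pairingsOf d A) (B := pairingsOf d B)
    (pairingsOf_subset _) (pairingsOf_subset _) (D := D) (by
      intro a ha b hb
      obtain ⟨ha, ha'⟩ := mem_pairingsOf.1 ha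
      obtain ⟨hb, hb'⟩ := mem_pairingsOf.1 hb
      refine (hc _ ha' _ hb').trans ?_
      exact_mod_cast ncard_diffVerts_le ha hb) hD
  have h2 := ncard_mul_card_pairings_le hn hA
  have h3 := ncard_mul_card_pairings_le hn hB
  rw [Fintype.card_prod, Fintype.card_fin, Fintype.card_fin, Nat.cast_mul] at h1
  set P : ℝ := (n * d + 1 : ℝ) ^ (2 * ((d + 1) * d))
  set R : ℝ := ((regularGraphs d n).ncard : ℝ)
  set Ω : ℝ := ((pairings (Fin n × Fin d)).card : ℝ)
  have hΩ : 0 < Ω := Nat.cast_pos.2 hne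
  have hP : 0 ≤ P := by positivity
  have hR : 0 ≤ R := by positivity
  have h4 : (A.ncard * B.ncard : ℝ) * Ω ^ 2 ≤
      ((P * R) ^ 2 * Real.exp (-(D ^ 2 / (256 * (n * d))))) * Ω ^ 2 := by
    calc (A.ncard * B.ncard : ℝ) * Ω ^ 2 = (A.ncard * Ω) * (B.ncard * Ω) := by ring
      _ ≤ (P * (R * (pairingsOf d A).card)) * (P * (R * (pairingsOf d B).card)) := by gcongr
      _ = (P * R) ^ 2 * ((pairingsOf d A).card * (pairingsOf d B).card) := by ring
      _ ≤ (P * R) ^ 2 * (Ω ^ 2 * Real.exp (-(D ^ 2 / (256 * (n * d))))) := by gcongr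
      _ = _ := by ring
  exact absurd (le_of_mul_le_mul_right h4 (by positivity)) (not_le.2 h)

end PairGraph

/-! ### Concentration for random regular graphs -/

section GraphProb

theorem mul_ncard_le_of_le_graphProb {d n : ℕ} {A : Set (SimpleGraph (Fin n))} {p : ℝ}
    (hp : 0 < p) (h : ENNReal.ofReal p ≤ graphProb d n A) :
    0 < (regularGraphs d n).ncard ∧
      p * (regularGraphs d n).ncard ≤ ((regularGraphs d n ∩ A).ncard : ℝ) := by
  have hpos : 0 < (regularGraphs d n).ncard := by
    rw [Nat.pos_iff_ne_zero]
    -- Without regular graphs the quotient would be `0 / 0 = 0`, against `0 < p`.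
    intro h0
    have h1 : (regularGraphs d n ∩ A).ncard = 0 :=
      Nat.le_zero.1 ((Set.ncard_le_ncard Set.inter_subset_left).trans h0.le)
    rw [graphProb, h1, h0] at h
    simp at h
    linarith
  refine ⟨hpos, ?_⟩
  rw [graphProb, ENNReal.le_div_iff_mul_le (Or.inl (by simpa using hpos.ne')) (Or.inl (by simp)),
    ← ENNReal.ofReal_natCast, ← ENNReal.ofReal_natCast, ← ENNReal.ofReal_mul hp.le] at h
  exact (ENNReal.ofReal_le_ofReal_iff (by positivity)).1 h

theorem tendsto_mul_add_one_pow_mul_exp (d k : ℕ) {a : ℝ} (ha : 0 < a) :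
    Tendsto (fun n : ℕ => (n * d + 1 : ℝ) ^ k * Real.exp (-a * n)) atTop (𝓝 0) := by
  have h0 := (tendsto_pow_const_mul_const_pow_of_lt_one k
    (r := Real.exp (-a)) (Real.exp_pos _).le
    (by rw [Real.exp_lt_one_iff]; linarith)).const_mul ((d + 1 : ℝ) ^ k)
  rw [mul_zero] at h0
  refine squeeze_zero' (Eventually.of_forall fun n => by positivity) ?_ h0
  filter_upwards [eventually_ge_atTop 1] with n hn
  have hn1 : (1 : ℝ) ≤ n := by exact_mod_cast hn
  rw [← mul_assoc, ← mul_pow, ← Real.exp_nat_mul, mul_comm (n : ℝ) (-a)]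
  gcongr
  nlinarith

/-- A set of regular graphs of not too small exponential rate and a set of probability bounded
below contain graphs which differ near few vertices only. -/
theorem exists_rate_forall_exists_close (d : ℕ) (hd : 1 ≤ d) : ∃ c : ℝ, 0 < c ∧
    ∀ θ : ℝ, 0 < θ → ∀ β : ℝ, 0 < β → ∀ᶠ n : ℕ in atTop, ∀ A B : Set (SimpleGraph (Fin n)),
      ENNReal.ofReal (Real.exp (-(c * θ ^ 2 * n))) ≤ graphProb d n A →
      ENNReal.ofReal β ≤ graphProb d n B →
      ∃ G ∈ regularGraphs d n ∩ A, ∃ G' ∈ regularGraphs d n ∩ B,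
        ((diffVerts G G').ncard : ℝ) ≤ θ * n := by
  have hd0 : (0 : ℝ) < d := by exact_mod_cast hd
  refine ⟨1 / (512 * d), by positivity, fun θ hθ β hβ => ?_⟩
  -- For `D = θ * n` the exponent is `2 * c * θ ^ 2 * n`. One half pays for the probability of `A`;
  -- the other beats the polynomial factor and `β`.
  set c : ℝ := 1 / (512 * d) with hc
  have hc0 : 0 < c := by positivity
  set C : ℕ := 2 * ((d + 1) * d) with hC
  have hlim : Tendsto (fun n : ℕ => (n * d + 1 : ℝ) ^ (2 * C) * Real.exp (-(c * θ ^ 2) * n)) atTop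
      (𝓝 0) := tendsto_mul_add_one_pow_mul_exp d (2 * C) (by positivity)
  filter_upwards [hlim.eventually (gt_mem_nhds hβ), eventually_ge_atTop (4 * (d + 1)),
    eventually_gt_atTop 0] with n h1 h2 hn0 A B hA hB
  obtain ⟨hR, hA'⟩ := mul_ncard_le_of_le_graphProb (Real.exp_pos _) hA
  obtain ⟨-, hB'⟩ := mul_ncard_le_of_le_graphProb hβ hB
  have hR' : (0 : ℝ) < (regularGraphs d n).ncard := by exact_mod_cast hR
  have hn : (0 : ℝ) < n := by exact_mod_cast hn0
  obtain ⟨G, hG, G', hG', hGG⟩ := exists_ncard_diffVerts_lt (n := n) (d := d)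
    (A := regularGraphs d n ∩ A) (B := regularGraphs d n ∩ B) (D := θ * n)
    (by rw [← mul_assoc]; exact Nat.mul_le_mul_right d h2)
    Set.inter_subset_left Set.inter_subset_left (by positivity) (by
      refine lt_of_lt_of_le ?_ (mul_le_mul hA' hB' (by positivity) (by positivity))
      have he : -((θ * n) ^ 2 / (256 * (n * d))) = -(c * θ ^ 2 * n) + -(c * θ ^ 2) * n := by
        rw [hc]
        field_simp
        norm_num
      rw [he, Real.exp_add]
      calc _ = Real.exp (-(c * θ ^ 2 * n)) * (regularGraphs d n).ncard *
            (((n * d + 1 : ℝ) ^ (2 * C) * Real.exp (-(c * θ ^ 2) * n)) *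
              (regularGraphs d n).ncard) := by ring
        _ < _ := by gcongr)
  exact ⟨G, hG, G', hG', hGG.le⟩

end GraphProb

/-! ### Locality of the breadth-first labeling -/

section Local

variable {n : ℕ}

theorem edist_le_succ_iff (G : SimpleGraph (Fin n)) (o v : Fin n) (k : ℕ) :
    G.edist o v ≤ ((k + 1 : ℕ) : ℕ∞) ↔
      G.edist o v ≤ k ∨ ∃ w, G.edist o w ≤ k ∧ G.Adj w v := by
  constructor
  · intro h
    obtain ⟨m, hm⟩ := ENat.ne_top_iff_exists.1 (ne_top_of_le_ne_top (ENat.natCast_ne_top _) h)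
    rw [← hm] at h
    have h' : m ≤ k + 1 := by exact_mod_cast h
    rcases Nat.le_succ_iff.1 h' with h1 | rfl
    · left
      rw [← hm]
      exact_mod_cast h1
    · obtain ⟨w, h1, h2⟩ := exists_pred G o hm.symm
      exact Or.inr ⟨w, h1.le, h2⟩
  · rintro (h | ⟨w, h1, h2⟩)
    · exact h.trans (by exact_mod_cast k.le_succ)
    · refine (SimpleGraph.edist_triangle (v := w)).trans ?_
      push_cast
      gcongr
      exact (SimpleGraph.edist_eq_one_iff_adj.2 h2).le

theorem edist_eq_succ_iff (G : SimpleGraph (Fin n)) (o v : Fin n) (k : ℕ) :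
    G.edist o v = ((k + 1 : ℕ) : ℕ∞) ↔
      G.edist o v ≤ ((k + 1 : ℕ) : ℕ∞) ∧ ¬ G.edist o v ≤ k := by
  rw [not_le, ← ENat.add_one_le_iff (ENat.natCast_ne_top k), le_antisymm_iff]
  push_cast
  rfl

/-- The graphs `G` and `G'` have the same neighbors at all vertices of the ball of radius `r`. -/
def AgreeOnBall (G G' : SimpleGraph (Fin n)) (o : Fin n) (r : ℕ) : Prop :=
  ∀ w, G.edist o w ≤ r → ∀ u, G.Adj w u ↔ G'.Adj w u

namespace AgreeOnBall

variable {G G' : SimpleGraph (Fin n)} {o : Fin n} {r : ℕ} (h : AgreeOnBall G G' o r)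

include h

theorem edist_le_iff {k : ℕ} (hk : k ≤ r) (v : Fin n) : G.edist o v ≤ k ↔ G'.edist o v ≤ k := by
  induction k generalizing v with
  | zero => simp
  | succ k ih =>
    have ih' := ih (Nat.le_of_succ_le hk)
    rw [edist_le_succ_iff, edist_le_succ_iff, ih']
    refine or_congr_right (exists_congr fun w => ?_)
    rw [← ih']
    refine and_congr_right fun hw => h w (hw.trans ?_) v
    exact_mod_cast Nat.le_of_succ_le hk

/-- The balls of radius `r` coincide, so agreement can be tested in either graph; the later
equalities then need only one implication. -/
protected theorem symm : AgreeOnBall G' G o r := fun w hw u =>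
  (h w ((h.edist_le_iff le_rfl w).2 hw) u).symm

theorem edist_eq_iff {k : ℕ} (hk : k ≤ r) (v : Fin n) : G.edist o v = k ↔ G'.edist o v = k := by
  cases k with
  | zero => simp
  | succ k =>
    rw [edist_eq_succ_iff, edist_eq_succ_iff, h.edist_le_iff hk,
      h.edist_le_iff (Nat.le_of_succ_le hk)]

theorem parentLabel_eq {k : ℕ} (hk : k ≤ r) (prev : Fin n → List ℕ) :
    parentLabel G o k prev = parentLabel G' o k prev := by
  classical
  funext u
  unfold parentLabel
  congr 3
  ext w
  simp only [Finset.mem_filter, Finset.mem_univ, true_and]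
  rw [← h.edist_eq_iff hk]
  refine and_congr_right fun hw => h w (hw.le.trans ?_) u
  exact_mod_cast hk

theorem levelLabel_eq (σ : Equiv.Perm (Fin n)) {k : ℕ} (hk : k ≤ r) :
    levelLabel G o σ k = levelLabel G' o σ k := by
  induction k with
  | zero => rfl
  | succ k ih =>
    have hk' := Nat.le_of_succ_le hk
    funext v
    simp only [levelLabel, ih hk', h.parentLabel_eq hk']
    congr 3
    refine Finset.filter_congr fun u _ => ?_
    rw [h.edist_eq_iff hk]

/-- The length of a label is the distance to the root, so a label of length at most `r` belongs to a
vertex of the ball, where the two searches coincide. -/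
theorem label_of_label (σ : Equiv.Perm (Fin n)) {u : Fin n} {a : List ℕ} (ha : a.length ≤ r)
    (hu : G.Reachable o u ∧ bfsLabel G o σ u = a) :
    (G'.Reachable o u ∧ bfsLabel G' o σ u = a) ∧ G.edist o u ≤ r := by
  obtain ⟨h1, rfl⟩ := hu
  rw [length_bfsLabel G o σ h1] at ha
  have h2 := h1.coe_dist_eq_edist.symm
  have h3 := (h.edist_eq_iff ha u).1 h2
  refine ⟨⟨reachable_of_edist G' o h3, ?_⟩, ?_⟩
  · rw [bfsLabel_of_dist G' o σ h3, bfsLabel_of_dist G o σ h2, h.levelLabel_eq σ ha]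
  · rw [h2]
    exact_mod_cast ha

theorem adj_of_adj {M : Type*} (f : Fin n → M) (σ : Equiv.Perm (Fin n)) {a b : List ℕ}
    (hab : ((bfsGraph G o σ f).trunc r).graph.Adj a b) :
    ((bfsGraph G' o σ f).trunc r).graph.Adj a b := by
  obtain ⟨⟨u, v, h1, h2, h3, h4⟩, ha, hb⟩ := hab
  obtain ⟨⟨h5, h6⟩, h7⟩ := h.label_of_label σ ha ⟨h1, h3⟩
  obtain ⟨⟨-, h8⟩, -⟩ := h.label_of_label σ hb ⟨h1.trans h2.reachable, h4⟩
  exact ⟨⟨u, v, h5, (h u h7 v).1 h2, h6, h8⟩, ha, hb⟩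

/-- The restriction of the labeled rooted graph to a ball only depends on the neighbors of the
vertices in the ball. -/
theorem trunc_bfsGraph_eq {M : Type*} (f : Fin n → M) (σ : Equiv.Perm (Fin n)) :
    (bfsGraph G o σ f).trunc r = (bfsGraph G' o σ f).trunc r := by
  classical
  ext a b
  · exact ⟨h.adj_of_adj f σ, h.symm.adj_of_adj f σ⟩
  · simp only [RootedGraph.trunc]
    by_cases ha : a.length ≤ r
    · have hP : (fun u => G.Reachable o u ∧ bfsLabel G o σ u = a) =
          fun u => G'.Reachable o u ∧ bfsLabel G' o σ u = a := by
        funext u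
        exact propext ⟨fun hu => (h.label_of_label σ ha hu).1,
          fun hu => (h.symm.label_of_label σ ha hu).1⟩
      -- Colors are read at a chosen vertex; equality of the predicates, not mere equivalence, makes
      -- the two choices agree.
      have key : ∀ P Q : Fin n → Prop, P = Q →
          (if h : ∃ u, P u then some (f h.choose) else none) =
            if h : ∃ u, Q u then some (f h.choose) else none := by
        rintro P Q rfl
        rfl
      rw [if_pos ha, if_pos ha]
      have := key _ _ hP
      simp only [bfsGraph]
      exact Eq.congr_left (by convert this)
    · simp [ha]

end AgreeOnBall

/-- Each unit of radius adds at most `d` neighbors per vertex, hence a factor `d + 1`. -/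
theorem ncard_ball_le {d : ℕ} {G : SimpleGraph (Fin n)} (hG : G ∈ regularGraphs d n)
    (T : Set (Fin n)) (k : ℕ) :
    {v | ∃ x ∈ T, G.edist x v ≤ k}.ncard ≤ T.ncard * (d + 1) ^ k := by
  classical
  induction k with
  | zero =>
    refine (Set.ncard_le_ncard (t := T) ?_).trans (by simp)
    rintro v ⟨x, hx, h⟩
    have : x = v := by simpa using h
    exact this ▸ hx
  | succ k ih =>
    set S := {v | ∃ x ∈ T, G.edist x v ≤ k} with hS
    have hsub : {v | ∃ x ∈ T, G.edist x v ≤ ((k + 1 : ℕ) : ℕ∞)} ⊆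
        (S.toFinset.biUnion fun w => insert w (G.neighborSet w).toFinset : Finset (Fin n)) := by
      rintro v ⟨x, hx, h⟩
      simp only [Finset.coe_biUnion, Set.mem_iUnion, Set.coe_toFinset, Finset.coe_insert,
        Set.mem_insert_iff, SimpleGraph.mem_neighborSet]
      rcases (edist_le_succ_iff G x v k).1 h with h1 | ⟨w, h1, h2⟩
      · exact ⟨v, ⟨x, hx, h1⟩, Or.inl rfl⟩
      · exact ⟨w, ⟨x, hx, h1⟩, Or.inr h2⟩
    refine (Set.ncard_le_ncard hsub).trans ?_
    rw [Set.ncard_coe_finset]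
    refine (Finset.card_biUnion_le_card_mul _ _ (d + 1) fun w _ => ?_).trans ?_
    · refine (Finset.card_insert_le _ _).trans ?_
      rw [← Set.ncard_eq_toFinset_card', hG w]
    · rw [← Set.ncard_eq_toFinset_card', pow_succ, ← mul_assoc]
      exact Nat.mul_le_mul_right _ ih

theorem agreeOnBall_of_notMem {G G' : SimpleGraph (Fin n)} {r : ℕ} {o : Fin n}
    (ho : o ∉ {v | ∃ x ∈ diffVerts G G', G.edist x v ≤ r}) : AgreeOnBall G G' o r := by
  intro w hw u
  by_contra hc
  exact ho ⟨w, ⟨u, hc⟩, by rwa [SimpleGraph.edist_comm]⟩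

end Local

/-! ### Total variation between local statistics -/

section TotalVariation

variable {M : Type*} {n : ℕ}

theorem restr_distr_apply [NeZero n] (G : SimpleGraph (Fin n)) (f : Fin n → M) (r : ℕ)
    {A : Set (RootedGraph M)} (hA : MeasurableSet A) :
    ((restr r (distr G f) : ProbabilityMeasure (RootedGraph M)) : Measure (RootedGraph M)).real A =
      ∑ v, (n : ℝ)⁻¹ * ((distrAt G f v).toMeasure (RootedGraph.trunc r ⁻¹' A)).toReal := by
  have hm := (RootedGraph.continuous_trunc (M := M) r).measurable
  have h1 : ((restr r (distr G f) : ProbabilityMeasure (RootedGraph M)) :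
      Measure (RootedGraph M)) A = ((PMF.uniformOfFintype (Fin n)).bind (distrAt G f)).toMeasure
        (RootedGraph.trunc r ⁻¹' A) := by
    rw [restr, ProbabilityMeasure.toMeasure_map, Measure.map_apply hm hA]
    rfl
  rw [Measure.real, h1, PMF.toMeasure_bind_apply _ _ _ (hm hA), tsum_fintype,
    ENNReal.toReal_sum]
  · simp
  · intro v _
    exact ENNReal.mul_ne_top (PMF.apply_ne_top _ _) (measure_ne_top _ _)

/-- The tie-breaking orders of the two graphs are coupled: for each `σ` the two truncated graphs are
equal. -/
theorem distrAt_apply_congr {G G' : SimpleGraph (Fin n)} {v : Fin n} {r : ℕ}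
    (h : AgreeOnBall G G' v r) (f : Fin n → M) {A : Set (RootedGraph M)} (hA : MeasurableSet A) :
    (distrAt G f v).toMeasure (RootedGraph.trunc r ⁻¹' A) =
      (distrAt G' f v).toMeasure (RootedGraph.trunc r ⁻¹' A) := by
  have hm := (RootedGraph.continuous_trunc (M := M) r).measurable hA
  rw [PMF.toMeasure_apply_eq_toOuterMeasure_apply _ hm,
    PMF.toMeasure_apply_eq_toOuterMeasure_apply _ hm, distrAt, distrAt,
    PMF.toOuterMeasure_map_apply, PMF.toOuterMeasure_map_apply]
  congr 1
  ext σ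
  simp only [Set.mem_preimage, h.trunc_bfsGraph_eq f σ]

/-- Graphs which differ near few vertices have close local statistics for all colorings. -/
theorem abs_restr_distr_sub_le {d : ℕ} [NeZero n] {G G' : SimpleGraph (Fin n)}
    (hG : G ∈ regularGraphs d n) (f : Fin n → M) (r : ℕ) {A : Set (RootedGraph M)}
    (hA : MeasurableSet A) :
    |((restr r (distr G f) : ProbabilityMeasure (RootedGraph M)) :
        Measure (RootedGraph M)).real A -
      ((restr r (distr G' f) : ProbabilityMeasure (RootedGraph M)) :
        Measure (RootedGraph M)).real A| ≤
      (diffVerts G G').ncard * (d + 1 : ℝ) ^ r / n := by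
  classical
  set B := {v | ∃ x ∈ diffVerts G G', G.edist x v ≤ r} with hB
  rw [restr_distr_apply G f r hA, restr_distr_apply G' f r hA, ← Finset.sum_sub_distrib]
  have hn : (0 : ℝ) < n := by exact_mod_cast NeZero.pos n
  -- Only the roots within distance `r` of a changed vertex contribute, by at most `1 / n` each.
  have h1 : ∀ v, |(n : ℝ)⁻¹ * ((distrAt G f v).toMeasure (RootedGraph.trunc r ⁻¹' A)).toReal -
      (n : ℝ)⁻¹ * ((distrAt G' f v).toMeasure (RootedGraph.trunc r ⁻¹' A)).toReal| ≤
      if v ∈ B then (n : ℝ)⁻¹ else 0 := by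
    intro v
    split_ifs with hv
    · have h2 : ∀ G : SimpleGraph (Fin n),
          ((distrAt G f v).toMeasure (RootedGraph.trunc r ⁻¹' A)).toReal ≤ 1 := fun G => by
        have := prob_le_one (μ := (distrAt G f v).toMeasure) (s := RootedGraph.trunc r ⁻¹' A)
        exact ENNReal.toReal_le_of_le_ofReal zero_le_one (by simpa using this)
      rw [← mul_sub, abs_mul, abs_of_pos (inv_pos.2 hn)]
      refine mul_le_of_le_one_right (inv_pos.2 hn).le ?_
      rw [abs_le]
      have h3 := h2 G
      have h4 := h2 G'
      have h5 := ENNReal.toReal_nonneg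
        (a := (distrAt G f v).toMeasure (RootedGraph.trunc r ⁻¹' A))
      have h6 := ENNReal.toReal_nonneg
        (a := (distrAt G' f v).toMeasure (RootedGraph.trunc r ⁻¹' A))
      constructor <;> linarith
    · rw [distrAt_apply_congr (agreeOnBall_of_notMem hv) f hA, sub_self, abs_zero]
  refine (Finset.abs_sum_le_sum_abs _ _).trans ((Finset.sum_le_sum fun v _ => h1 v).trans ?_)
  rw [← Finset.sum_filter, Finset.sum_const, nsmul_eq_mul, ← div_eq_mul_inv]
  gcongr
  have h2 := ncard_ball_le hG (diffVerts G G') r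
  rw [← hB, Set.ncard_eq_toFinset_card', Set.toFinset_card, Fintype.card_subtype] at h2
  exact_mod_cast h2

end TotalVariation

/-! ### Stability of weak neighborhoods under total variation -/

section WeakTopology

variable {X : Type*} [TopologicalSpace X] [MeasurableSpace X] [OpensMeasurableSpace X]
  {D : ProbabilityMeasure X → ProbabilityMeasure X → ℝ}

/-- A distance which generates the weak topology is controlled, near a given measure, by the total
variation distance. -/
theorem GeneratesWeakTopology.exists_pos_forall_le [HasOuterApproxClosed X]
    (hD : GeneratesWeakTopology D) (ν : ProbabilityMeasure X) {ε : ℝ} (hε : 0 < ε) :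
    ∃ η : ℝ, 0 < η ∧ ∀ ρ ρ' : ProbabilityMeasure X, D ρ ν ≤ η →
      (∀ A : Set X, MeasurableSet A →
        |(ρ : Measure X).real A - (ρ' : Measure X).real A| ≤ η) → D ρ' ν ≤ ε := by
  by_contra! hc
  -- Failure for `η = 1 / (k + 1)` gives sequences with `ρ k` tending to `ν` and `ρ' k`
  -- asymptotically equal to it in total variation, but `ρ' k` bounded away from `ν`.
  choose ρ ρ' h1 h2 h3 using fun k : ℕ => hc (1 / (k + 1 : ℝ)) (by positivity)
  have hlim : Tendsto ρ atTop (𝓝 ν) := by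
    rw [(hD.nhds_basis ν).tendsto_right_iff]
    intro e he
    filter_upwards [tendsto_one_div_add_atTop_nhds_zero_nat.eventually (gt_mem_nhds he)] with k hk
    exact (h1 k).trans_lt hk
  -- By the portmanteau criterion on open sets; the gap between `c₁` and `c₂` absorbs the error `1 /
  -- (k + 1)`.
  have hlim' : Tendsto ρ' atTop (𝓝 ν) := by
    refine tendsto_of_forall_isOpen_le_liminf' fun U hU => le_of_forall_lt fun c hc => ?_
    obtain ⟨c₁, hc₁, hc₁'⟩ := exists_between hc
    obtain ⟨c₂, hc₂, hc₂'⟩ := exists_between hc₁'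
    refine hc₁.trans_le (le_liminf_of_le (by isBoundedDefault) ?_)
    have hU' := ProbabilityMeasure.le_liminf_measure_open_of_tendsto hlim hU
    have hsmall : Tendsto (fun k : ℕ => c₁ + ENNReal.ofReal (1 / (k + 1 : ℝ))) atTop (𝓝 c₁) := by
      simpa using (ENNReal.tendsto_ofReal tendsto_one_div_add_atTop_nhds_zero_nat).const_add c₁
    filter_upwards [eventually_lt_of_lt_liminf (hc₂'.trans_le hU'),
      hsmall.eventually (gt_mem_nhds hc₂)] with k hk1 hk2
    have h4 : (ρ k : Measure X) U ≤ (ρ' k : Measure X) U + ENNReal.ofReal (1 / (k + 1 : ℝ)) := by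
      rw [← ofReal_measureReal (measure_ne_top _ _), ← ofReal_measureReal (measure_ne_top _ _),
        ← ENNReal.ofReal_add measureReal_nonneg (by positivity)]
      refine ENNReal.ofReal_le_ofReal ?_
      have := (abs_le.1 (h2 k U hU.measurableSet)).2
      linarith
    exact (ENNReal.add_le_add_iff_right ENNReal.ofReal_ne_top).1 (hk2.le.trans (hk1.le.trans h4))
  obtain ⟨k, hk⟩ := (((hD.nhds_basis ν).tendsto_right_iff.1 hlim') ε hε).exists
  exact absurd (h3 k) (not_lt.2 (le_of_lt hk))

end WeakTopology

/-! ### Exponential rates and complementary events -/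

section Rates

theorem neg_le_log_div_iff {n : ℕ} (hn : 0 < n) (p : ℝ≥0∞) (κ : ℝ) :
    ((-κ : ℝ) : EReal) ≤ ENNReal.log p / (n : EReal) ↔
      ENNReal.ofReal (Real.exp (-(κ * n))) ≤ p := by
  rw [EReal.le_div_iff_mul_le (by exact_mod_cast hn) (EReal.natCast_ne_top n),
    ← ENNReal.log_le_log_iff, ENNReal.log_ofReal_of_pos (Real.exp_pos _), Real.log_exp]
  norm_cast
  rw [neg_mul]

theorem graphProb_mono {d n : ℕ} {A B : Set (SimpleGraph (Fin n))} (h : A ⊆ B) :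
    graphProb d n A ≤ graphProb d n B := by
  unfold graphProb
  gcongr
  exact Set.toFinite _

theorem graphProb_add_compl {d n : ℕ} (h : 0 < (regularGraphs d n).ncard)
    (A : Set (SimpleGraph (Fin n))) : graphProb d n A + graphProb d n Aᶜ = 1 := by
  unfold graphProb
  rw [ENNReal.div_add_div_same, ← Nat.cast_add, ← Set.ncard_union_eq, ← Set.inter_union_distrib_left,
    Set.union_compl_self, Set.inter_univ]
  · exact ENNReal.div_self (by simpa using h.ne') (by simp)
  · exact disjoint_compl_right.mono Set.inter_subset_right Set.inter_subset_right

theorem le_graphProb_of_compl_lt {d n : ℕ} (h : 0 < (regularGraphs d n).ncard)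
    {A : Set (SimpleGraph (Fin n))} {α : ℝ} (hα : 0 ≤ α)
    (hA : ¬ ENNReal.ofReal (1 - α) ≤ graphProb d n Aᶜ) :
    ENNReal.ofReal α ≤ graphProb d n A := by
  rw [not_le] at hA
  have h1 := graphProb_add_compl h A
  by_contra! h2
  have h3 : graphProb d n A + graphProb d n Aᶜ < ENNReal.ofReal α + ENNReal.ofReal (1 - α) :=
    ENNReal.add_lt_add h2 hA
  have h4 : 0 ≤ 1 - α := by
    by_contra! h5
    rw [ENNReal.ofReal_of_nonpos h5.le] at hA
    exact not_lt_bot hA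
  rw [h1, ← ENNReal.ofReal_add hα h4] at h3
  simp at h3

theorem eventually_pos_sizes (d : ℕ) : ∀ᶠ n in sizes d, 0 < n :=
  (eventually_gt_atTop 0).filter_mono inf_le_left

end Rates

/-! ### Comparison of entropies and the theorem -/

section Deduction

variable {M : Type*} [Finite M] [MeasurableSpace M] [MeasurableSingletonClass M] {d : ℕ}
  {D : ProbabilityMeasure (RootedGraph M) → ProbabilityMeasure (RootedGraph M) → ℝ}
  {μ : ProbabilityMeasure (treeVerts d → M)} {r : ℕ}

/-- Measures at distance at most `ε₁` from the local law of `μ` stay at distance at most `ε₂` from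
it when they are changed by at most `t` in total variation. -/
def StableUnder (D : ProbabilityMeasure (RootedGraph M) → ProbabilityMeasure (RootedGraph M) → ℝ)
    (μ : ProbabilityMeasure (treeVerts d → M)) (r : ℕ) (ε₁ ε₂ t : ℝ) : Prop :=
  ∀ ρ ρ' : ProbabilityMeasure (RootedGraph M), D ρ (restr r (treeLaw μ)) ≤ ε₁ →
    (∀ A : Set (RootedGraph M), MeasurableSet A →
      |(ρ : Measure (RootedGraph M)).real A - (ρ' : Measure (RootedGraph M)).real A| ≤ t) →
    D ρ' (restr r (treeLaw μ)) ≤ ε₂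

/-- The same colorings work: a coloring good for `G` at tolerance `ε₁` is good for `G'` at tolerance
`ε₂`. -/
theorem StableUnder.entropyH_le {ε₁ ε₂ θ : ℝ}
    (hs : StableUnder D μ r ε₁ ε₂ (θ * (d + 1 : ℝ) ^ r)) {n : ℕ} {G G' : SimpleGraph (Fin n)}
    (hG : G ∈ regularGraphs d n) (hGG : ((diffVerts G G').ncard : ℝ) ≤ θ * n) :
    entropyH D μ r G ε₁ ≤ entropyH D μ r G' ε₂ := by
  refine EReal.div_le_div_right_of_nonneg (by positivity) (ENNReal.log_monotone ?_)
  have hsub : colorings D μ r G ε₁ ⊆ colorings D μ r G' ε₂ := by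
    rintro f ⟨hn, hf⟩
    have hn0 : (0 : ℝ) < n := by exact_mod_cast NeZero.pos n
    refine ⟨hn, hs _ _ hf fun A hA => (abs_restr_distr_sub_le hG f r hA).trans ?_⟩
    rw [div_le_iff₀ hn0]
    calc ((diffVerts G G').ncard : ℝ) * (d + 1 : ℝ) ^ r ≤ θ * n * (d + 1 : ℝ) ^ r := by gcongr
      _ = _ := by ring
  exact_mod_cast Set.ncard_le_ncard hsub (Set.toFinite _)

theorem diffVerts_comm {n : ℕ} (G G' : SimpleGraph (Fin n)) :
    diffVerts G G' = diffVerts G' G := by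
  ext u
  exact exists_congr fun v => not_congr iff_comm

/-- Otherwise the event that the entropy at tolerance `ε₂` is below `h` has probability at least `1
- α`, and one of its graphs is close to a graph with entropy at least `h` at tolerance `ε₁`. -/
theorem StableUnder.eventually_le_graphProb {c ε₁ ε₂ θ : ℝ}
    (hc : ∀ θ : ℝ, 0 < θ → ∀ β : ℝ, 0 < β → ∀ᶠ n : ℕ in atTop, ∀ A B : Set (SimpleGraph (Fin n)),
      ENNReal.ofReal (Real.exp (-(c * θ ^ 2 * n))) ≤ graphProb d n A →
      ENNReal.ofReal β ≤ graphProb d n B →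
      ∃ G ∈ regularGraphs d n ∩ A, ∃ G' ∈ regularGraphs d n ∩ B,
        ((diffVerts G G').ncard : ℝ) ≤ θ * n)
    (hs : StableUnder D μ r ε₁ ε₂ (θ * (d + 1 : ℝ) ^ r)) (hθ : 0 < θ) {α : ℝ} (hα : 0 < α)
    (hα1 : α < 1) (h : EReal) :
    ∀ᶠ n in sizes d, ((-(c * θ ^ 2) : ℝ) : EReal) < rateGE D μ r h ε₁ n →
      ENNReal.ofReal α ≤ graphProb d n {G | h ≤ entropyH D μ r G ε₂} := by
  filter_upwards [(hc θ hθ (1 - α) (by linarith)).filter_mono inf_le_left,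
    eventually_pos_sizes d] with n hn hn0 hr
  have hA := (neg_le_log_div_iff hn0 _ _).1 hr.le
  refine le_graphProb_of_compl_lt (mul_ncard_le_of_le_graphProb (Real.exp_pos _) hA).1 hα.le
    fun hB => ?_
  obtain ⟨G, ⟨hG, hGA⟩, G', ⟨-, hGB⟩, hGG⟩ := hn _ _ hA hB
  exact hGB (le_trans hGA (hs.entropyH_le hG hGG))

/-- A median above `h` gives a set of probability at least `α` with entropy above `h` at tolerance
`ε₁`; it contains a graph close to one with entropy at most `h` at tolerance `ε₂`. -/
theorem StableUnder.eventually_medianEntropy_le {c ε₁ ε₂ θ : ℝ}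
    (hc : ∀ θ : ℝ, 0 < θ → ∀ β : ℝ, 0 < β → ∀ᶠ n : ℕ in atTop, ∀ A B : Set (SimpleGraph (Fin n)),
      ENNReal.ofReal (Real.exp (-(c * θ ^ 2 * n))) ≤ graphProb d n A →
      ENNReal.ofReal β ≤ graphProb d n B →
      ∃ G ∈ regularGraphs d n ∩ A, ∃ G' ∈ regularGraphs d n ∩ B,
        ((diffVerts G G').ncard : ℝ) ≤ θ * n)
    (hs : StableUnder D μ r ε₁ ε₂ (θ * (d + 1 : ℝ) ^ r)) (hθ : 0 < θ) {α : ℝ} (hα : 0 < α)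
    (h : EReal) :
    ∀ᶠ n in sizes d, ((-(c * θ ^ 2) : ℝ) : EReal) < rateLE D μ r h ε₂ n →
      medianEntropy D μ r n ε₁ α ≤ h := by
  filter_upwards [(hc θ hθ α hα).filter_mono inf_le_left, eventually_pos_sizes d] with n hn hn0 hr
  have hA := (neg_le_log_div_iff hn0 _ _).1 hr.le
  refine sSup_le fun x hx => ?_
  by_contra! hhx
  obtain ⟨G, ⟨-, hGA⟩, G', ⟨hG', hGB⟩, hGG⟩ := hn _ _ hA hx.2
  rw [diffVerts_comm] at hGG
  exact absurd (hhx.trans_le (le_trans hGB (hs.entropyH_le hG' hGG))) (not_lt.2 hGA)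

theorem le_medianEntropy {n : ℕ} {ε α : ℝ} {h : EReal} (hh : h ∈ entropyRange)
    (hp : ENNReal.ofReal α ≤ graphProb d n {G | h ≤ entropyH D μ r G ε}) :
    h ≤ medianEntropy D μ r n ε α := le_sSup ⟨hh, hp⟩

/-- A subexponential lower bound for the probability that the entropy is at least `h` improves to
all probabilities less than one. -/
theorem exists_eventually_le_medianEntropy (hd : 1 ≤ d) (hD : GeneratesWeakTopology D)
    {h : EReal} (hh : h ∈ entropyRange) {δ : ℝ → EReal} (hδ : Tendsto δ (𝓝[>] 0) (𝓝 0))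
    {α : ℝ} (hα : 0 < α) (hα1 : α < 1) {ε : ℝ} (hε : 0 < ε) :
    ∃ ε₀ : ℝ, 0 < ε₀ ∧ ∃ κ : EReal, κ < -δ ε₀ ∧ ∀ᶠ n in sizes d,
      κ < rateGE D μ r h ε₀ n → h ≤ medianEntropy D μ r n ε α := by
  obtain ⟨c, hc0, hc⟩ := exists_rate_forall_exists_close d hd
  obtain ⟨η, hη, hst⟩ := hD.exists_pos_forall_le (restr r (treeLaw μ)) hε
  set θ : ℝ := η / (d + 1 : ℝ) ^ r with hθdef
  have hθ : 0 < θ := by positivity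
  have hκ : (0 : EReal) < ((c * θ ^ 2 : ℝ) : EReal) := by
    have : 0 < c * θ ^ 2 := by positivity
    exact_mod_cast this
  -- Here `θ` depends only on the final tolerance `ε`, so `ε₀` can be taken small afterwards, and
  -- `δ` tending to zero is enough.
  obtain ⟨ε₀, hε₀, hδ₀, hle⟩ := ((eventually_mem_nhdsWithin (s := Ioi (0 : ℝ)) (a := 0)).and
    ((hδ.eventually (gt_mem_nhds hκ)).and
      (eventually_nhdsWithin_of_eventually_nhds (eventually_le_nhds hη)))).exists
  have hs : StableUnder D μ r ε₀ ε (θ * (d + 1 : ℝ) ^ r) := by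
    rw [hθdef, div_mul_cancel₀ _ (by positivity)]
    exact fun ρ ρ' h1 h2 => hst ρ ρ' (h1.trans hle) h2
  refine ⟨ε₀, hε₀, ((-(c * θ ^ 2) : ℝ) : EReal), ?_, ?_⟩
  · rw [EReal.coe_neg]
    exact EReal.neg_lt_neg_iff.2 hδ₀
  · filter_upwards [hs.eventually_le_graphProb hc hθ hα hα1 h] with n hn hr
    exact le_medianEntropy hh (hn hr)

theorem le_upperEntropy_of_rateGE (hd : 1 ≤ d) (hD : GeneratesWeakTopology D)
    {h : EReal} (hh : h ∈ entropyRange) {δ : ℝ → EReal} (hδ : Tendsto δ (𝓝[>] 0) (𝓝 0))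
    (hr : ∀ ε, 0 < ε → -δ ε ≤ limsup (rateGE D μ r h ε) (sizes d))
    {α : ℝ} (hα : 0 < α) (hα1 : α < 1) : h ≤ upperEntropy D μ r α := by
  refine le_iInf₂ fun ε hε => ?_
  obtain ⟨ε₀, hε₀, κ, hκ, hev⟩ :=
    exists_eventually_le_medianEntropy (μ := μ) (r := r) hd hD hh hδ hα hα1 hε
  exact le_limsup_of_frequently_le
    (((frequently_lt_of_lt_limsup (by isBoundedDefault) (hκ.trans_le (hr ε₀ hε₀))).and_eventually
      hev).mono fun n hn => hn.2 hn.1)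

theorem le_lowerEntropy_of_rateGE (hd : 1 ≤ d) (hD : GeneratesWeakTopology D)
    {h : EReal} (hh : h ∈ entropyRange) {δ : ℝ → EReal} (hδ : Tendsto δ (𝓝[>] 0) (𝓝 0))
    (hr : ∀ ε, 0 < ε → -δ ε ≤ liminf (rateGE D μ r h ε) (sizes d))
    {α : ℝ} (hα : 0 < α) (hα1 : α < 1) : h ≤ lowerEntropy D μ r α := by
  refine le_iInf₂ fun ε hε => ?_
  obtain ⟨ε₀, hε₀, κ, hκ, hev⟩ :=
    exists_eventually_le_medianEntropy (μ := μ) (r := r) hd hD hh hδ hα hα1 hε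
  refine le_liminf_of_le (by isBoundedDefault) ?_
  filter_upwards [eventually_lt_of_lt_liminf (hκ.trans_le (hr ε₀ hε₀)), hev] with n h1 h2
  exact h2 h1

/-- A lower bound of small exponential rate for the probability that the entropy is at most `h`
bounds the medians. -/
theorem exists_eventually_medianEntropy_le (hd : 1 ≤ d) (hD : GeneratesWeakTopology D)
    (hTV : BoundedByTotalVariation D) (h : EReal) {δ : ℝ → EReal}
    (hδ : Tendsto (fun ε : ℝ => δ ε / ((ε ^ 2 : ℝ) : EReal)) (𝓝[>] 0) (𝓝 0))
    {α : ℝ} (hα : 0 < α) :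
    ∃ ε : ℝ, 0 < ε ∧ ∃ κ : EReal, κ < -δ ε ∧ ∀ᶠ n in sizes d,
      κ < rateLE D μ r h ε n → medianEntropy D μ r n (ε / 2) α ≤ h := by
  obtain ⟨c, hc0, hc⟩ := exists_rate_forall_exists_close d hd
  obtain ⟨C₀, hC₀⟩ := hTV
  set C : ℝ := max C₀ 1 with hCdef
  have hC : 0 < C := lt_max_of_lt_right one_pos
  -- With `θ = τ * ε`, the change in `D` is at most `ε / 2`, and the admissible rate `c * τ ^ 2 * ε
  -- ^ 2` is of order `ε ^ 2`.
  set τ : ℝ := 1 / (2 * C * (d + 1 : ℝ) ^ r) with hτdef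
  have hτ : 0 < τ := by positivity
  have hκ : (0 : EReal) < ((c * τ ^ 2 : ℝ) : EReal) := by
    have : 0 < c * τ ^ 2 := by positivity
    exact_mod_cast this
  obtain ⟨ε, hε, hδε⟩ := ((eventually_mem_nhdsWithin (s := Ioi (0 : ℝ)) (a := 0)).and
    (hδ.eventually (gt_mem_nhds hκ))).exists
  replace hε : 0 < ε := hε
  have hs : StableUnder D μ r (ε / 2) ε (τ * ε * (d + 1 : ℝ) ^ r) := by
    intro ρ ρ' h1 h2
    have h3 := hC₀ ρ ρ' _ h2
    have h4 : C₀ * (τ * ε * (d + 1 : ℝ) ^ r) ≤ ε / 2 := by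
      calc C₀ * (τ * ε * (d + 1 : ℝ) ^ r) ≤ C * (τ * ε * (d + 1 : ℝ) ^ r) := by
            gcongr
            exact le_max_left _ _
        _ = ε / 2 := by
            rw [hτdef]
            field_simp
    have h5 := hD.triangle ρ' ρ (restr r (treeLaw μ))
    rw [hD.symm ρ' ρ] at h5
    linarith
  refine ⟨ε, hε, ((-(c * (τ * ε) ^ 2) : ℝ) : EReal), ?_,
    hs.eventually_medianEntropy_le hc (by positivity) hα h⟩
  rw [EReal.coe_neg]
  refine EReal.neg_lt_neg_iff.2 ?_
  have hε2 : (0 : EReal) < ((ε ^ 2 : ℝ) : EReal) := by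
    have : 0 < ε ^ 2 := by positivity
    exact_mod_cast this
  rw [EReal.div_lt_iff hε2 (EReal.coe_ne_top _)] at hδε
  refine hδε.trans_le (le_of_eq ?_)
  rw [← EReal.coe_mul]
  congr 1
  ring

theorem upperEntropy_le_of_rateLE (hd : 1 ≤ d) (hD : GeneratesWeakTopology D)
    (hTV : BoundedByTotalVariation D) {h : EReal} {δ : ℝ → EReal}
    (hδ : Tendsto (fun ε : ℝ => δ ε / ((ε ^ 2 : ℝ) : EReal)) (𝓝[>] 0) (𝓝 0))
    (hr : ∀ ε, 0 < ε → -δ ε ≤ liminf (rateLE D μ r h ε) (sizes d)) {α : ℝ} (hα : 0 < α) :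
    upperEntropy D μ r α ≤ h := by
  obtain ⟨ε, hε, κ, hκ, hev⟩ :=
    exists_eventually_medianEntropy_le (μ := μ) (r := r) hd hD hTV h hδ hα
  refine iInf₂_le_of_le (ε / 2) (half_pos hε) (limsup_le_of_le (by isBoundedDefault) ?_)
  filter_upwards [eventually_lt_of_lt_liminf (hκ.trans_le (hr ε hε)), hev] with n h1 h2
  exact h2 h1

theorem lowerEntropy_le_of_rateLE (hd : 1 ≤ d) (hD : GeneratesWeakTopology D)
    (hTV : BoundedByTotalVariation D) {h : EReal} {δ : ℝ → EReal}
    (hδ : Tendsto (fun ε : ℝ => δ ε / ((ε ^ 2 : ℝ) : EReal)) (𝓝[>] 0) (𝓝 0))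
    (hr : ∀ ε, 0 < ε → -δ ε ≤ limsup (rateLE D μ r h ε) (sizes d)) {α : ℝ} (hα : 0 < α) :
    lowerEntropy D μ r α ≤ h := by
  obtain ⟨ε, hε, κ, hκ, hev⟩ :=
    exists_eventually_medianEntropy_le (μ := μ) (r := r) hd hD hTV h hδ hα
  refine iInf₂_le_of_le (ε / 2) (half_pos hε) (liminf_le_of_frequently_le
    (((frequently_lt_of_lt_limsup (by isBoundedDefault) (hκ.trans_le (hr ε hε))).and_eventually
      hev).mono fun n hn => hn.2 hn.1))

/-- If the median exceeds `x`, then the entropy is at least `max x 0` with probability at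
least `α`. -/
theorem le_graphProb_of_lt_medianEntropy {n : ℕ} {ε α : ℝ} {x : EReal} (hx : ⊥ < x)
    (h : x < medianEntropy D μ r n ε α) :
    ENNReal.ofReal α ≤ graphProb d n {G | max x 0 ≤ entropyH D μ r G ε} := by
  obtain ⟨y, ⟨hy, hp⟩, hxy⟩ := lt_sSup_iff.1 h
  refine hp.trans (graphProb_mono fun G hG => le_trans (max_le hxy.le ?_) hG)
  exact (hy.resolve_left (hx.trans hxy).ne').1

/-- A constant probability eventually exceeds `exp (-ε * n)`, so `δ ε = ε` is admissible in the
lower bounds. -/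
theorem eventually_neg_le_rateGE {α ε : ℝ} (hα : 0 < α) (hε : 0 < ε) (h : EReal) :
    ∀ᶠ n in sizes d, ENNReal.ofReal α ≤ graphProb d n {G | h ≤ entropyH D μ r G ε} →
      -(ε : EReal) ≤ rateGE D μ r h ε n := by
  have hlim : Tendsto (fun n : ℕ => Real.exp (-(ε * n))) atTop (𝓝 0) :=
    Real.tendsto_exp_neg_atTop_nhds_zero.comp
      (tendsto_natCast_atTop_atTop.const_mul_atTop hε)
  filter_upwards [(hlim.eventually (gt_mem_nhds hα)).filter_mono inf_le_left,
    eventually_pos_sizes d] with n h1 h2 hp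
  rw [← EReal.coe_neg]
  exact (neg_le_log_div_iff h2 _ _).2 ((ENNReal.ofReal_le_ofReal h1.le).trans hp)

theorem max_zero_mem_entropyRange {x y : EReal} (h : x < y) : max x 0 ∈ entropyRange :=
  Or.inr ⟨le_max_right _ _, max_lt (lt_top_of_lt h) EReal.zero_lt_top⟩

theorem tendsto_coe_nhdsGT_zero : Tendsto (fun ε : ℝ => (ε : EReal)) (𝓝[>] 0) (𝓝 0) :=
  (continuous_coe_real_ereal.tendsto' 0 0 EReal.coe_zero).mono_left nhdsWithin_le_nhds

/-- For `x` below the entropy at level `α`, the entropy of the graph is frequently at least `max x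
0` with probability at least `α`. The lower bound raises this to level `β`. The maximum with `0`
puts the threshold in `entropyRange`. -/
theorem upperEntropy_le_upperEntropy (hd : 1 ≤ d) (hD : GeneratesWeakTopology D) {α β : ℝ}
    (hα : 0 < α) (hβ : 0 < β) (hβ1 : β < 1) :
    upperEntropy D μ r α ≤ upperEntropy D μ r β := by
  refine le_of_forall_lt_imp_le_of_dense fun x hx => ?_
  rcases eq_bot_or_bot_lt x with rfl | hx0
  · exact bot_le
  refine (le_max_left x 0).trans (le_upperEntropy_of_rateGE hd hD (max_zero_mem_entropyRange hx)
    tendsto_coe_nhdsGT_zero (fun ε hε => ?_) hβ hβ1)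
  have h1 : x < limsup (fun n => medianEntropy D μ r n ε α) (sizes d) :=
    hx.trans_le (iInf₂_le ε hε)
  exact le_limsup_of_frequently_le
    (((frequently_lt_of_lt_limsup (by isBoundedDefault) h1).and_eventually
      (eventually_neg_le_rateGE hα hε (max x 0))).mono fun n hn =>
        hn.2 (le_graphProb_of_lt_medianEntropy hx0 hn.1))

theorem lowerEntropy_le_lowerEntropy (hd : 1 ≤ d) (hD : GeneratesWeakTopology D) {α β : ℝ}
    (hα : 0 < α) (hβ : 0 < β) (hβ1 : β < 1) :
    lowerEntropy D μ r α ≤ lowerEntropy D μ r β := by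
  refine le_of_forall_lt_imp_le_of_dense fun x hx => ?_
  rcases eq_bot_or_bot_lt x with rfl | hx0
  · exact bot_le
  refine (le_max_left x 0).trans (le_lowerEntropy_of_rateGE hd hD (max_zero_mem_entropyRange hx)
    tendsto_coe_nhdsGT_zero (fun ε hε => ?_) hβ hβ1)
  have h1 : x < liminf (fun n => medianEntropy D μ r n ε α) (sizes d) :=
    hx.trans_le (iInf₂_le ε hε)
  refine le_liminf_of_le (by isBoundedDefault) ?_
  filter_upwards [eventually_lt_of_lt_liminf h1,
    eventually_neg_le_rateGE (μ := μ) (r := r) (D := D) hα hε (max x 0)] with n h2 h3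
  exact h3 (le_graphProb_of_lt_medianEntropy hx0 h2)

end Deduction

end Sofic

theorem theorem2p1 {M : Type*} [Finite M] [MeasurableSpace M] [MeasurableSingletonClass M]
    (d : ℕ) (hd : 3 ≤ d)
    (D : ProbabilityMeasure (Sofic.RootedGraph M) → ProbabilityMeasure (Sofic.RootedGraph M) → ℝ)
    (hD : Sofic.GeneratesWeakTopology D)
    (μ : ProbabilityMeasure (Sofic.treeVerts d → M)) (hμ : Sofic.IsInvariant μ)
    (r : ℕ) :
    (∀ h ∈ Sofic.entropyRange, ∀ δ : ℝ → EReal, (∀ ε, 0 < ε → 0 < δ ε) →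
      Tendsto δ (𝓝[>] 0) (𝓝 0) →
      ((∀ ε, 0 < ε → -δ ε ≤ limsup (Sofic.rateGE D μ r h ε) (Sofic.sizes d)) →
        ∀ α : ℝ, 0 < α → α < 1 → h ≤ Sofic.upperEntropy D μ r α) ∧
      ((∀ ε, 0 < ε → -δ ε ≤ liminf (Sofic.rateGE D μ r h ε) (Sofic.sizes d)) →
        ∀ α : ℝ, 0 < α → α < 1 → h ≤ Sofic.lowerEntropy D μ r α) ∧
      (Sofic.BoundedByTotalVariation D →
        Tendsto (fun ε : ℝ => δ ε / ((ε ^ 2 : ℝ) : EReal)) (𝓝[>] 0) (𝓝 0) →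
        ((∀ ε, 0 < ε → -δ ε ≤ liminf (Sofic.rateLE D μ r h ε) (Sofic.sizes d)) →
          ∀ α : ℝ, 0 < α → α < 1 → Sofic.upperEntropy D μ r α ≤ h) ∧
        ((∀ ε, 0 < ε → -δ ε ≤ limsup (Sofic.rateLE D μ r h ε) (Sofic.sizes d)) →
          ∀ α : ℝ, 0 < α → α < 1 → Sofic.lowerEntropy D μ r α ≤ h))) ∧
    (∀ α β : ℝ, 0 < α → α < 1 → 0 < β → β < 1 →
      Sofic.upperEntropy D μ r α = Sofic.upperEntropy D μ r β ∧
        Sofic.lowerEntropy D μ r α = Sofic.lowerEntropy D μ r β) := by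
  have hd1 : 1 ≤ d := by omega
  refine ⟨fun h hh δ _ hδ => ⟨fun hr α hα hα1 => ?_, fun hr α hα hα1 => ?_,
    fun hTV hδ2 => ⟨fun hr α hα _ => ?_, fun hr α hα _ => ?_⟩⟩, fun α β hα hα1 hβ hβ1 => ⟨?_, ?_⟩⟩
  · exact Sofic.le_upperEntropy_of_rateGE hd1 hD hh hδ hr hα hα1
  · exact Sofic.le_lowerEntropy_of_rateGE hd1 hD hh hδ hr hα hα1
  · exact Sofic.upperEntropy_le_of_rateLE hd1 hD hTV hδ2 hr hα
  · exact Sofic.lowerEntropy_le_of_rateLE hd1 hD hTV hδ2 hr hα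
  · exact le_antisymm (Sofic.upperEntropy_le_upperEntropy hd1 hD hα hβ hβ1)
      (Sofic.upperEntropy_le_upperEntropy hd1 hD hβ hα hα1)
  · exact le_antisymm (Sofic.lowerEntropy_le_lowerEntropy hd1 hD hα hβ hβ1)
      (Sofic.lowerEntropy_le_lowerEntropy hd1 hD hβ hα hα1)
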